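/- Let $d$ be a dimension, $\mathbb{T}^d=\mathbb{R}^d/\mathbb{Z}^d$, and let $V\subset\mathbb{R}^d$ be bounded, open and non-empty, with Lebesgue measure $|V|$. Put $\nu_x=\mathrm{d}x$ on $\mathbb{T}^d$, $\nu_v=|V|^{-1}\,\mathrm{d}v$ on $V$ and $\nu=\nu_x\otimes\nu_v$. Let $p:V\times V\to\mathbb{R}$ be measurable with $p(v,v')\ge \gamma/|V|$ for all $v,v'\in V$ and some constant $\gamma>0$, with $\int_V p(v,v')\,\mathrm{d}v=1$ for every $v'\in V$ (conservation of mass), and with $\int_V p(v,v')\,\mathrm{d}v'=1$ for a.e. $v\in V$ (so that $\nu$ is an equilibrium). Let $(T_t)_{t\ge0}$ be the free transport semigroup on measures on $\mathbb{T}^d\times V$, i.e. $T_t\mu$ is the image of $\mu$ under $(x,v)\mapsto(x+tv,v)$. (i) There exist $T_*\in[0,\infty)$ and $\beta\in(0,1)$ such that, as measures on $\mathbb{T}^d$, $$\int_V T_t(\delta_{x_0}\otimes\nu_v)\,\mathrm{d}v\;\ge\;\beta\,\nu_x\qquad\text{for all } t\ge T_*,\ x_0\in\mathbb{T}^d, \tag{H}$$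 where $\int_V\cdot\,\mathrm{d}v$ denotes the marginal on $\mathbb{T}^d$. (ii) Let $T_*\ge0$ and $\beta\in(0,1)$ be any constants satisfying (H). Let $\sigma\in C^0(\mathbb{T}^d)$, $\sigma\ge0$, satisfy the geometric control condition with constants $T>0$, $\kappa>0$: $$\inf_{(x,v)\in\mathbb{T}^d\times V}\int_0^T\sigma(x+tv)\,\mathrm{d}t\ge\kappa .$$ Put $$\lambda=-\frac{1}{2T+T_*}\log\!\left(1-\beta\gamma^2\kappa^2e^{-(2T+T_*)\|\sigma\|_\infty}\right).$$ Then $\lambda>0$. Let $\mu_0$ be a probability measure on $\mathbb{T}^d\times V$ and let $(\mu_t)_{t\ge0}$ be a measure solution of the linear Boltzmann equation $$\partial_t\mu+v\cdot\nabla_x\mu=\sigma\,(L^+\mu-\mu),\qquad \mu|_{t=0}=\mu_0,\qquad L^+\mu(\mathrm{d}x,\mathrm{d}v)=\Big(\int_{V}p(v,v')\,\mu(\mathrm{d}x,\mathrm{d}v')\Big)\mathrm{d}v,$$ that is, a weakly continuous curve of probability measures on $\mathbb{T}^d\times V$ such that for every $\tau>0$ and every $\phi\in C^1_c([0,\tau)\times\mathbb{T}^d\times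 V)$ $$\int_0^\tau\!\!\iint\Big(\partial_t\phi+v\cdot\nabla_x\phi+\sigma(x)\Big(\int_Vp(w,v)\phi(t,x,w)\,\mathrm{d}w-\phi\Big)\Big)\,\mu_t(\mathrm{d}x,\mathrm{d}v)\,\mathrm{d}t=-\iint\phi(0,x,v)\,\mu_0(\mathrm{d}x,\mathrm{d}v).$$ Then $$\|\mu_t-\nu\|_{TV}\le e^{-\lambda(t-2T-T_*)}\,\|\mu_0-\nu\|_{TV}\qquad\text{for all } t\ge T_*,$$ where $\|m\|_{TV}=\sup\{\int\phi\,\mathrm{d}m:\ \phi\in C_b(\mathbb{T}^d\times V),\ \|\phi\|_\infty\le1\}$. -/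

import Mathlib

open MeasureTheory Set

noncomputable section

namespace Boltzmann

/-- The Euclidean space `ℝ^d`. -/
abbrev Vel (d : ℕ) : Type := EuclideanSpace ℝ (Fin d)

/-- The flat torus `𝕋^d = ℝ^d / ℤ^d`; its volume is the Lebesgue measure, of total mass `1`. -/
abbrev Torus (d : ℕ) : Type := UnitAddTorus (Fin d)

/-- The canonical projection `ℝ^d → 𝕋^d`. -/
def toTorus {d : ℕ} (y : Vel d) : Torus d := fun i => ((y i : ℝ) : UnitAddCircle)

/-- The phase space `𝕋^d × V`. -/
abbrev Phase {d : ℕ} (V : Set (Vel d)) : Type := Torus d × V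

/-- The Lebesgue measure on `V ⊆ ℝ^d`, as a measure on the subtype. -/
def leb {d : ℕ} (V : Set (Vel d)) : Measure V :=
  (volume : Measure (Vel d)).comap Subtype.val

/-- `ν_v`: the uniform probability measure `dv / |V|` on `V`. -/
def nuV {d : ℕ} (V : Set (Vel d)) : Measure V := (volume V)⁻¹ • leb V

/-- `ν_x = dx` on the torus (no potential). -/
def nuX (d : ℕ) : Measure (Torus d) := volume

/-- `ν = ν_x ⊗ ν_v`. -/
def nu {d : ℕ} (V : Set (Vel d)) : Measure (Phase V) := (nuX d).prod (nuV V)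

/-- Free flow: `(x, v) ↦ (x + t v, v)`. -/
def flow {d : ℕ} (V : Set (Vel d)) (t : ℝ) (z : Phase V) : Phase V :=
  (z.1 + toTorus (t • (z.2 : Vel d)), z.2)

/-- The free transport semigroup on measures: push-forward along the free flow. -/
def transport {d : ℕ} (V : Set (Vel d)) (t : ℝ) (m : Measure (Phase V)) : Measure (Phase V) :=
  m.map (flow V t)

/-- `Tstar ≥ 0` and `β ∈ (0,1)` are such that for all `t ≥ Tstar` and all `x₀ ∈ 𝕋^d`, the spatial
marginal of `T_t (δ_{x₀} ⊗ ν_v)` is at least `β ν_x`, as measures on the torus. -/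
def SpreadsMass {d : ℕ} (V : Set (Vel d)) (Tstar β : ℝ) : Prop :=
  0 ≤ Tstar ∧ β ∈ Ioo (0 : ℝ) 1 ∧
    ∀ t : ℝ, Tstar ≤ t → ∀ x₀ : Torus d,
      ENNReal.ofReal β • nuX d ≤
        (transport V t ((Measure.dirac x₀).prod (nuV V))).map Prod.fst

/-- The geometric control condition for free transport, with constants `T` and `κ`. -/
def GCC {d : ℕ} (V : Set (Vel d)) (σ : C(Torus d, ℝ)) (T κ : ℝ) : Prop :=
  0 < T ∧ 0 < κ ∧
    ∀ (x : Torus d) (v : V), κ ≤ ∫ t in (0 : ℝ)..T, σ (x + toTorus (t • (v : Vel d)))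

/-- Test functions `φ ∈ C¹_c([0,τ) × 𝕋^d × V)`, given by a `C¹` extension to `ℝ × 𝕋^d × ℝ^d`
whose support is compact and contained in `(-∞,τ) × 𝕋^d × V`. Being `C¹` on the torus means that
the `ℤ^d`-periodic lift is `C¹`. -/
structure IsTest {d : ℕ} (V : Set (Vel d)) (τ : ℝ) (φ : ℝ → Torus d → Vel d → ℝ) : Prop where
  contDiff : ContDiff ℝ 1 (fun z : ℝ × Vel d × Vel d => φ z.1 (toTorus z.2.1) z.2.2)
  compact_support :
    HasCompactSupport (fun z : ℝ × Torus d × Vel d => φ z.1 z.2.1 z.2.2)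
  support_subset : ∀ z ∈ tsupport (fun z : ℝ × Torus d × Vel d => φ z.1 z.2.1 z.2.2),
    z.1 < τ ∧ z.2.2 ∈ V

/-- The dual equation's operator applied to `φ`:
`∂_t φ + v · ∇_x φ + σ (L φ - φ)`, with `(L φ)(t,x,v) = ∫_V p(w,v) φ(t,x,w) dw`, the adjoint of
`L⁺ μ (dx dv) = (∫ p(v,v') μ(dx dv')) dv`. -/
def dualOp {d : ℕ} (V : Set (Vel d)) (σ : C(Torus d, ℝ)) (p : V → V → ℝ)
    (φ : ℝ → Torus d → Vel d → ℝ) (t : ℝ) (z : Phase V) : ℝ :=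
  deriv (fun s : ℝ => φ s z.1 z.2) t
    + deriv (fun h : ℝ => φ t (z.1 + toTorus (h • (z.2 : Vel d))) z.2) 0
    + σ z.1 * ((∫ w : V, p w z.2 * φ t z.1 w ∂(leb V)) - φ t z.1 z.2)

/-- `μ` is, on `[0,τ]`, a measure solution of
`∂_t μ + v · ∇_x μ = σ (L⁺ μ - μ)`, `μ|_{t=0} = μ₀`: it is a weakly continuous curve of probability
measures on `𝕋^d × V` that satisfies the equation against all test functions. -/
def IsMeasureSolutionOn {d : ℕ} (V : Set (Vel d)) (σ : C(Torus d, ℝ)) (p : V → V → ℝ)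
    (τ : ℝ) (μ₀ : ProbabilityMeasure (Phase V)) (μ : ℝ → ProbabilityMeasure (Phase V)) : Prop :=
  ContinuousOn μ (Icc 0 τ) ∧
    ∀ φ : ℝ → Torus d → Vel d → ℝ, IsTest V τ φ →
      ∫ t in (0 : ℝ)..τ, ∫ z, dualOp V σ p φ t z ∂(μ t : Measure (Phase V))
        = - ∫ z, φ 0 z.1 z.2 ∂(μ₀ : Measure (Phase V))

/-- Measure solutions on `[0,∞)`. -/
def IsMeasureSolution {d : ℕ} (V : Set (Vel d)) (σ : C(Torus d, ℝ)) (p : V → V → ℝ)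
    (μ₀ : ProbabilityMeasure (Phase V)) (μ : ℝ → ProbabilityMeasure (Phase V)) : Prop :=
  ∀ τ : ℝ, 0 < τ → IsMeasureSolutionOn V σ p τ μ₀ μ

/-- `‖m₁ - m₂‖_TV = sup { ∫ φ dm₁ - ∫ φ dm₂ : φ ∈ C_b, ‖φ‖_∞ ≤ 1 }`, for finite measures. -/
def tvDist {X : Type*} [TopologicalSpace X] [MeasurableSpace X] (m₁ m₂ : Measure X) : ℝ :=
  sSup {r : ℝ | ∃ φ : BoundedContinuousFunction X ℝ, ‖φ‖ ≤ 1 ∧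
    r = ∫ z, φ z ∂m₁ - ∫ z, φ z ∂m₂}

/-- The rate `λ = -(2T+T_*)⁻¹ log(1 - β γ² κ² exp(-(2T+T_*) ‖σ‖_∞))`, `s = ‖σ‖_∞`. -/
def rate (T Tstar β γ κ s : ℝ) : ℝ :=
  - (1 / (2 * T + Tstar)) *
    Real.log (1 - β * γ ^ 2 * κ ^ 2 * Real.exp (-(2 * T + Tstar) * s))

end Boltzmann

end

/-! Part (ii) is Doeblin's theorem for the uniformized jump process. Write M = ‖σ‖ and σ(L⁺ - 1) = N
- M with N = (M - σ) + σL⁺. The jump operator N is positive and, since collisions conserve mass, has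
total mass M at every point. In the frame of the free flow, with weight e^{Ms}, the solution ρ_s =
e^{Ms} T_{-s} μ_s satisfies ρ_s = ρ_0 + ∫_0^s N_q* ρ_q dq, where N_q is N conjugated by the flow. No
negative term is left, so everything can be done with nonnegative integrals.

Iterating this equation bounds ρ_t from below by a Dyson series (`IsIntegralSolution.dyson_le`).
Both sides have total mass e^{Mt} ρ_0(1), so the bound is an equality
(`IsIntegralSolution.lintegral_eq`). Every solution is therefore the image of its initial value
under one explicit Markov functional; uniqueness comes for free, without a semigroup construction.

Over a time 2T + T_*, the second term of the series already dominates ν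
(`IsScattering.minorization`). One collision in the first window of length T draws a fresh velocity;
at least T_* of free flight then spreads the position by (H); one collision in the last window of
length T draws the velocity again. Each window contributes γκ and the flight β. Removing the weight
leaves a minorization by α = βγ²κ²e^{-(2T+T_*)M}, so the distance to the stationary ν shrinks by 1 -
α in each period (`tvDist_le_of_minorized`). Rounding t down to whole periods costs the shift in the
exponent.

A weak solution is brought to the integral form by testing with functions constant along
trajectories, up to a cut-off in time and the weight e^{Mt}: the transport term cancels and a du
Bois-Reymond argument in time remains (`IsMeasureSolution.integral_pulled_eq`). Trigonometric
polynomials times velocity bumps then identify the measures (`ext_of_isPhaseTest`).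

For part (i), V contains a cube. For large t, trim it to side n/t with n an integer: multiplied by
t, it wraps each circle exactly n times, so its image on the torus is exactly uniform. -/

noncomputable section

namespace Boltzmann

open ProbabilityTheory
open scoped ENNReal

/-! ### Positive integral equations and their Dyson series -/

section Dyson

variable {E : Type*} [MeasurableSpace E]

/-- The Volterra operator `F ↦ ((r, z) ↦ ∫_r^t 𝒩_s F_s (z) ds)` of a time-dependent kernel. -/
def volterra (κ : Kernel (ℝ × E) E) (t : ℝ) (F : ℝ × E → ℝ≥0∞) (x : ℝ × E) : ℝ≥0∞ :=
  ∫⁻ s in Ioc x.1 t, ∫⁻ y, F (s, y) ∂(κ (s, x.2))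

theorem measurable_kernel_apply (κ : Kernel (ℝ × E) E) [IsSFiniteKernel κ]
    {F : ℝ × E → ℝ≥0∞} (hF : Measurable F) :
    Measurable fun x : ℝ × E => ∫⁻ y, F (x.1, y) ∂(κ x) := by
  have h : Measurable fun q : (ℝ × E) × E => F (q.1.1, q.2) := by fun_prop
  exact h.lintegral_kernel_prod_right'

theorem measurable_volterra (κ : Kernel (ℝ × E) E) [IsSFiniteKernel κ] (t : ℝ)
    {F : ℝ × E → ℝ≥0∞} (hF : Measurable F) : Measurable (volterra κ t F) := by
  have h1 := measurable_kernel_apply κ hF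
  have h2 : Measurable fun q : (ℝ × E) × ℝ =>
      (Ioc q.1.1 t).indicator (fun s => ∫⁻ y, F (s, y) ∂(κ (s, q.1.2))) q.2 := by
    have h3 : Measurable fun q : (ℝ × E) × ℝ => ∫⁻ y, F (q.2, y) ∂(κ (q.2, q.1.2)) :=
      h1.comp (by fun_prop : Measurable fun q : (ℝ × E) × ℝ => (q.2, q.1.2))
    have hS : MeasurableSet {q : (ℝ × E) × ℝ | q.1.1 < q.2 ∧ q.2 ≤ t} :=
      MeasurableSet.inter (s₁ := {q : (ℝ × E) × ℝ | q.1.1 < q.2})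
        (s₂ := {q : (ℝ × E) × ℝ | q.2 ≤ t})
        (measurableSet_lt (by fun_prop) (by fun_prop))
        (measurableSet_le (by fun_prop) (by fun_prop))
    exact h3.indicator hS
  have h4 := h2.lintegral_prod_right' (ν := (volume : Measure ℝ))
  convert h4 using 2 with x
  simp only [volterra]
  rw [lintegral_indicator measurableSet_Ioc]

theorem volterra_add (κ : Kernel (ℝ × E) E) [IsSFiniteKernel κ] (t : ℝ)
    {F G : ℝ × E → ℝ≥0∞} (hF : Measurable F) :
    volterra κ t (F + G) = volterra κ t F + volterra κ t G := by
  funext x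
  simp only [volterra, Pi.add_apply]
  rw [← lintegral_add_left]
  · refine lintegral_congr fun s => ?_
    exact lintegral_add_left (by fun_prop) _
  · exact (measurable_kernel_apply κ hF).comp
      (by fun_prop : Measurable fun s : ℝ => (s, x.2))

theorem measurable_volterra_iterate (κ : Kernel (ℝ × E) E) [IsSFiniteKernel κ] (t : ℝ)
    {F : ℝ × E → ℝ≥0∞} (hF : Measurable F) (n : ℕ) : Measurable ((volterra κ t)^[n] F) := by
  induction n with
  | zero => exact hF
  | succ n ih => rw [Function.iterate_succ_apply']; exact measurable_volterra κ t ih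

theorem volterra_iterate_add (κ : Kernel (ℝ × E) E) [IsSFiniteKernel κ] (t : ℝ)
    {F G : ℝ × E → ℝ≥0∞} (hF : Measurable F) (n : ℕ) :
    (volterra κ t)^[n] (F + G) = (volterra κ t)^[n] F + (volterra κ t)^[n] G := by
  induction n with
  | zero => rfl
  | succ n ih =>
    rw [Function.iterate_succ_apply', ih, volterra_add κ t (measurable_volterra_iterate κ t hF n),
      Function.iterate_succ_apply', Function.iterate_succ_apply']

/-- As the mass of the kernel is the constant M, the iterates depend on time only: Mⁿ times the
volume of the simplex of n ordered times in [r, t]. -/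
theorem volterra_iterate_one (κ : Kernel (ℝ × E) E) {M : ℝ} (hM : 0 ≤ M)
    (hκ : ∀ x, κ x univ = ENNReal.ofReal M) {t : ℝ} (n : ℕ) :
    ∀ r ≤ t, ∀ z, (volterra κ t)^[n] (fun _ => 1) (r, z)
      = ENNReal.ofReal ((M * (t - r)) ^ n / n.factorial) := by
  induction n with
  | zero => intro r _ z; simp
  | succ n ih =>
    intro r hr z
    rw [Function.iterate_succ_apply']
    simp only [volterra]
    have h1 : ∫⁻ s in Ioc r t, ∫⁻ y, (volterra κ t)^[n] (fun _ => 1) (s, y) ∂(κ (s, z))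
        = ∫⁻ s in Ioc r t, ENNReal.ofReal (M * ((M * (t - s)) ^ n / n.factorial)) := by
      refine setLIntegral_congr_fun measurableSet_Ioc fun s hs => ?_
      have h2 : ∀ y, (volterra κ t)^[n] (fun _ => 1) (s, y)
          = ENNReal.ofReal ((M * (t - s)) ^ n / n.factorial) := fun y => ih s hs.2 y
      simp only [h2, lintegral_const, hκ]
      rw [mul_comm, ← ENNReal.ofReal_mul hM]
    rw [h1, ← ofReal_integral_eq_lintegral_ofReal]
    · congr 1
      rw [← intervalIntegral.integral_of_le hr]
      have hd : ∀ s ∈ uIcc r t, HasDerivAt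
          (fun s => -((M * (t - s)) ^ (n + 1) / (n + 1).factorial))
          (M * ((M * (t - s)) ^ n / n.factorial)) s := by
        intro s _
        have h0 : HasDerivAt (fun s : ℝ => M * (t - s)) (-M) s := by
          simpa using ((hasDerivAt_id s).const_sub t).const_mul M
        have h3 := ((h0.pow (n + 1)).div_const ((n + 1).factorial : ℝ)).neg
        refine h3.congr_deriv ?_
        rw [Nat.factorial_succ]
        push_cast
        field_simp
      rw [intervalIntegral.integral_eq_sub_of_hasDerivAt hd
        (Continuous.intervalIntegrable (by fun_prop) _ _)]
      simp
    · exact (Continuous.integrableOn_Icc (by fun_prop)).mono_set Ioc_subset_Icc_self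
    · refine (ae_restrict_iff' measurableSet_Ioc).2 (Filter.Eventually.of_forall fun s hs => ?_)
      have : 0 ≤ t - s := sub_nonneg.2 hs.2
      positivity

/-- The Dyson series `∑ₙ Uⁿ f` at time `0`. -/
def dyson (κ : Kernel (ℝ × E) E) (t : ℝ) (f : E → ℝ≥0∞) (z : E) : ℝ≥0∞ :=
  ∑' n, (volterra κ t)^[n] (fun x => f x.2) (0, z)

theorem measurable_dyson (κ : Kernel (ℝ × E) E) [IsSFiniteKernel κ] (t : ℝ) {f : E → ℝ≥0∞}
    (hf : Measurable f) : Measurable (dyson κ t f) := by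
  refine Measurable.tsum fun n => ?_
  exact (measurable_volterra_iterate κ t (by fun_prop) n).comp (by fun_prop)

theorem dyson_add (κ : Kernel (ℝ × E) E) [IsSFiniteKernel κ] (t : ℝ) {f g : E → ℝ≥0∞}
    (hf : Measurable f) (z : E) : dyson κ t (f + g) z = dyson κ t f z + dyson κ t g z := by
  unfold dyson
  rw [← ENNReal.tsum_add]
  refine tsum_congr fun n => ?_
  have h := volterra_iterate_add κ t (F := fun x : ℝ × E => f x.2) (G := fun x : ℝ × E => g x.2)
    (by fun_prop) n
  exact congrFun h (0, z)

theorem dyson_one (κ : Kernel (ℝ × E) E) {M : ℝ} (hM : 0 ≤ M)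
    (hκ : ∀ x, κ x univ = ENNReal.ofReal M) {t : ℝ} (ht : 0 ≤ t) (z : E) :
    dyson κ t (fun _ => 1) z = ENNReal.ofReal (Real.exp (M * t)) := by
  unfold dyson
  have h : ∀ n, (volterra κ t)^[n] (fun _ => 1) (0, z)
      = ENNReal.ofReal ((M * t) ^ n / n.factorial) := by
    intro n
    rw [volterra_iterate_one κ hM hκ n 0 ht z, sub_zero]
  simp only [h]
  rw [← ENNReal.ofReal_tsum_of_nonneg (fun n => by positivity) (Real.summable_pow_div_factorial _),
    Real.exp_eq_exp_ℝ, NormedSpace.exp_eq_tsum_div]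

/-- Solutions on `[0, t]` of the integral equation `ρ_s = ρ_0 + ∫_0^s 𝒩_q* ρ_q dq`. -/
def IsIntegralSolution (κ : Kernel (ℝ × E) E) (t : ℝ) (ρ : Kernel ℝ E) : Prop :=
  ∀ s ∈ Icc 0 t, ∀ f : E → ℝ≥0∞, Measurable f →
    ∫⁻ z, f z ∂(ρ s) = ∫⁻ z, f z ∂(ρ 0) +
      ∫⁻ q in Ioc 0 s, ∫⁻ z, ∫⁻ y, f y ∂(κ (q, z)) ∂(ρ q)

variable {κ : Kernel (ℝ × E) E} [IsSFiniteKernel κ] {t : ℝ} {ρ : Kernel ℝ E} [IsSFiniteKernel ρ]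

/-- Insert the integral equation at time s into the source term, then exchange the two ordered
times. This is one step of the Duhamel iteration. -/
theorem IsIntegralSolution.volterra_step (h : IsIntegralSolution κ t ρ)
    {F : ℝ × E → ℝ≥0∞} (hF : Measurable F) :
    ∫⁻ s in Ioc 0 t, ∫⁻ z, ∫⁻ y, F (s, y) ∂(κ (s, z)) ∂(ρ s)
      = ∫⁻ z, volterra κ t F (0, z) ∂(ρ 0) +
        ∫⁻ s in Ioc 0 t, ∫⁻ z, ∫⁻ y, volterra κ t F (s, y) ∂(κ (s, z)) ∂(ρ s) := by
  have hN := measurable_kernel_apply κ hF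
  have hN' : ∀ s, Measurable fun z => ∫⁻ y, F (s, y) ∂(κ (s, z)) := fun s =>
    hN.comp (by fun_prop : Measurable fun z : E => (s, z))
  -- the two-time integrand
  have hG : Measurable fun a : (ℝ × ℝ) × E =>
      ∫⁻ y, ∫⁻ y', F (a.1.2, y') ∂(κ (a.1.2, y)) ∂(κ (a.1.1, a.2)) := by
    have hb : Measurable fun b : ((ℝ × ℝ) × E) × E => ∫⁻ y', F (b.1.1.2, y') ∂(κ (b.1.1.2, b.2)) :=
      hN.comp (by fun_prop : Measurable fun b : ((ℝ × ℝ) × E) × E => (b.1.1.2, b.2))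
    let κ' : Kernel ((ℝ × ℝ) × E) E := κ.comap (fun a => (a.1.1, a.2)) (by fun_prop)
    exact hb.lintegral_kernel_prod_right' (κ := κ')
  have hH : Measurable fun a : ℝ × ℝ =>
      ∫⁻ z, ∫⁻ y, ∫⁻ y', F (a.2, y') ∂(κ (a.2, y)) ∂(κ (a.1, z)) ∂(ρ a.1) := by
    let ρ' : Kernel (ℝ × ℝ) E := ρ.comap Prod.fst measurable_fst
    exact hG.lintegral_kernel_prod_right' (κ := ρ')
  have h1 : ∫⁻ s in Ioc 0 t, ∫⁻ z, ∫⁻ y, F (s, y) ∂(κ (s, z)) ∂(ρ s)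
      = ∫⁻ s in Ioc 0 t, ((∫⁻ z, ∫⁻ y, F (s, y) ∂(κ (s, z)) ∂(ρ 0)) +
        ∫⁻ q in Ioc 0 s, ∫⁻ z, ∫⁻ y, ∫⁻ y', F (s, y') ∂(κ (s, y)) ∂(κ (q, z)) ∂(ρ q)) := by
    refine setLIntegral_congr_fun measurableSet_Ioc fun s hs => ?_
    exact h s ⟨hs.1.le, hs.2⟩ _ (hN' s)
  rw [h1, lintegral_add_left]
  swap
  · have hb : Measurable fun a : ℝ × E => ∫⁻ y, F (a.1, y) ∂(κ (a.1, a.2)) := hN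
    exact hb.lintegral_prod_right' (ν := ρ 0)
  congr 1
  · rw [lintegral_lintegral_swap]
    · rfl
    · exact hN.aemeasurable
  · -- Tonelli on the triangle `q < s`
    have hS : MeasurableSet {a : ℝ × ℝ | a.1 < a.2} :=
      measurableSet_lt measurable_fst measurable_snd
    have h2 : ∫⁻ s in Ioc 0 t, ∫⁻ q in Ioc 0 s,
          ∫⁻ z, ∫⁻ y, ∫⁻ y', F (s, y') ∂(κ (s, y)) ∂(κ (q, z)) ∂(ρ q)
        = ∫⁻ s in Ioc 0 t, ∫⁻ q in Ioc 0 t, {a : ℝ × ℝ | a.1 < a.2}.indicator (fun a =>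
          ∫⁻ z, ∫⁻ y, ∫⁻ y', F (a.2, y') ∂(κ (a.2, y)) ∂(κ (a.1, z)) ∂(ρ a.1)) (q, s) := by
      refine setLIntegral_congr_fun measurableSet_Ioc fun s hs => ?_
      rw [← restrict_Ioo_eq_restrict_Ioc, ← lintegral_indicator measurableSet_Ioo,
        ← lintegral_indicator measurableSet_Ioc]
      refine lintegral_congr fun q => ?_
      simp only [indicator_apply, mem_Ioo, mem_Ioc, mem_ofPred_eq]
      by_cases hq : q < s
      · by_cases hq0 : 0 < q
        · simp [hq, hq0, hq.le.trans hs.2]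
        · simp [hq0]
      · simp [hq]
    rw [h2, lintegral_lintegral_swap]
    swap
    · exact ((hH.indicator hS).comp measurable_swap).aemeasurable
    refine setLIntegral_congr_fun measurableSet_Ioc fun q hq => ?_
    have h3 : ∀ z, ∫⁻ y, volterra κ t F (q, y) ∂(κ (q, z))
        = ∫⁻ s in Ioc q t, ∫⁻ y, ∫⁻ y', F (s, y') ∂(κ (s, y)) ∂(κ (q, z)) := by
      intro z
      simp only [volterra]
      rw [lintegral_lintegral_swap]
      exact (hN.comp (by fun_prop : Measurable fun b : E × ℝ => (b.2, b.1))).aemeasurable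
    simp only [h3]
    rw [lintegral_lintegral_swap]
    swap
    · exact (hG.comp (by fun_prop : Measurable fun b : E × ℝ => ((q, b.2), b.1))).aemeasurable
    rw [← lintegral_indicator measurableSet_Ioc, ← lintegral_indicator measurableSet_Ioc]
    refine lintegral_congr fun s => ?_
    simp only [indicator_apply, mem_Ioc, mem_ofPred_eq]
    by_cases hqs : q < s
    · simp [hqs, hq.1.trans hqs]
    · simp [hqs]

/-- After n iterations the solution is a partial sum of the series plus a nonnegative remainder.
Dropping the remainder gives the bound, without showing that it tends to zero. -/
theorem IsIntegralSolution.dyson_le (h : IsIntegralSolution κ t ρ) (ht : 0 ≤ t)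
    {f : E → ℝ≥0∞} (hf : Measurable f) :
    ∫⁻ z, dyson κ t f z ∂(ρ 0) ≤ ∫⁻ z, f z ∂(ρ t) := by
  set U : ℕ → ℝ × E → ℝ≥0∞ := fun n => (volterra κ t)^[n] (fun x => f x.2) with hU
  have hUm : ∀ n, Measurable (U n) := measurable_volterra_iterate κ t (by fun_prop)
  have key : ∀ n : ℕ, ∫⁻ z, f z ∂(ρ t) = ∑ k ∈ Finset.range (n + 1), ∫⁻ z, U k (0, z) ∂(ρ 0) +
      ∫⁻ s in Ioc 0 t, ∫⁻ z, ∫⁻ y, U n (s, y) ∂(κ (s, z)) ∂(ρ s) := by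
    intro n
    induction n with
    | zero => simpa [hU] using h t ⟨ht, le_rfl⟩ f hf
    | succ n ih =>
      rw [ih, h.volterra_step (hUm n), Finset.sum_range_succ _ (n + 1), add_assoc]
      simp only [hU, Function.iterate_succ_apply']
  have hUm0 : ∀ n, AEMeasurable (fun z => U n (0, z)) (ρ 0) := fun n =>
    ((hUm n).comp (by fun_prop : Measurable fun z : E => ((0 : ℝ), z))).aemeasurable
  change ∫⁻ z, ∑' n, U n (0, z) ∂(ρ 0) ≤ _
  rw [lintegral_tsum hUm0, ENNReal.tsum_eq_iSup_nat]
  refine iSup_le fun n => ?_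
  rw [key n]
  exact (Finset.sum_le_sum_of_subset (Finset.range_mono n.le_succ)).trans le_self_add

/-- A solution with the right mass is given by the Dyson series. -/
theorem IsIntegralSolution.lintegral_eq (h : IsIntegralSolution κ t ρ) (ht : 0 ≤ t)
    {M : ℝ} (hM : 0 ≤ M) (hκ : ∀ x, κ x univ = ENNReal.ofReal M) [IsFiniteMeasure (ρ 0)]
    (hmass : ρ t univ = ENNReal.ofReal (Real.exp (M * t)) * ρ 0 univ)
    {f : E → ℝ≥0∞} (hf : Measurable f) (hf1 : ∀ z, f z ≤ 1) :
    ∫⁻ z, f z ∂(ρ t) = ∫⁻ z, dyson κ t f z ∂(ρ 0) := by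
  have hg : Measurable (1 - f) := measurable_const.sub hf
  have hfg : f + (1 - f) = fun _ => 1 := by
    funext z; exact add_tsub_cancel_of_le (hf1 z)
  -- The lower bound holds for f and for 1 - f, and the two bounds add up to the same finite total
  -- mass; neither inequality can be strict.
  have h1 := h.dyson_le ht hf
  have h2 := h.dyson_le ht hg
  have h3 : ∫⁻ z, dyson κ t f z ∂(ρ 0) + ∫⁻ z, dyson κ t (1 - f) z ∂(ρ 0) = ρ t univ := by
    rw [← lintegral_add_left (measurable_dyson κ t hf), hmass]
    simp_rw [← dyson_add κ t hf, hfg, dyson_one κ hM hκ ht]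
    simp
  have h4 : ∫⁻ z, f z ∂(ρ t) + ∫⁻ z, (1 - f) z ∂(ρ t) = ρ t univ := by
    rw [← lintegral_add_left hf]
    have : ∀ z, f z + (1 - f) z = 1 := fun z => congrFun hfg z
    simp only [this, lintegral_const, one_mul]
  have hfin : ρ t univ ≠ ∞ := by
    rw [hmass]; exact ENNReal.mul_ne_top ENNReal.ofReal_ne_top (measure_ne_top _ _)
  refine le_antisymm ?_ h1
  have h5 : ∫⁻ z, (1 - f) z ∂(ρ t) ≠ ∞ := ne_top_of_le_ne_top hfin (h4 ▸ le_add_self)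
  refine (ENNReal.add_le_add_iff_right h5).1 ?_
  rw [h4, ← h3]
  gcongr

end Dyson

/-! ### Total variation distance and Doeblin contraction -/

section TotalVariation

variable {X : Type*} [TopologicalSpace X] [MeasurableSpace X]

theorem bddAbove_tvDist [OpensMeasurableSpace X] (m₁ m₂ : Measure X) [IsFiniteMeasure m₁]
    [IsFiniteMeasure m₂] :
    BddAbove {r : ℝ | ∃ φ : BoundedContinuousFunction X ℝ, ‖φ‖ ≤ 1 ∧
      r = ∫ z, φ z ∂m₁ - ∫ z, φ z ∂m₂} := by
  refine ⟨m₁.real univ + m₂.real univ, ?_⟩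
  rintro r ⟨φ, hφ, rfl⟩
  have h : ∀ (m : Measure X) [IsFiniteMeasure m], |∫ z, φ z ∂m| ≤ m.real univ := by
    intro m _
    have := norm_integral_le_of_norm_le_const (μ := m) (f := φ) (C := 1)
      (Filter.Eventually.of_forall fun z => (φ.norm_coe_le_norm z).trans hφ)
    simpa using this
  have h1 := abs_le.1 (h m₁)
  have h2 := abs_le.1 (h m₂)
  linarith

/-- Bounded measurable functions may be used as test functions for the total variation. -/
theorem integral_sub_le_tvDist [NormalSpace X] [BorelSpace X] (m₁ m₂ : Measure X)
    [IsFiniteMeasure m₁] [IsFiniteMeasure m₂] [(m₁ + m₂).WeaklyRegular]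
    {f : X → ℝ} (hf : Measurable f) (hf1 : ∀ z, |f z| ≤ 1) :
    ∫ z, f z ∂m₁ - ∫ z, f z ∂m₂ ≤ tvDist m₁ m₂ := by
  have hint : ∀ (m : Measure X) [IsFiniteMeasure m], Integrable f m := fun m _ =>
    Integrable.of_bound hf.aestronglyMeasurable 1 (Filter.Eventually.of_forall hf1)
  refine le_of_forall_pos_le_add fun ε hε => ?_
  obtain ⟨g, hg, -⟩ := (hint (m₁ + m₂)).exists_boundedContinuous_integral_sub_le hε
  -- Clipping to [-1, 1] is 1-Lipschitz and fixes f, so it makes the test function admissible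
  -- without worsening the approximation. Approximating in L¹(m₁ + m₂) controls both measures at
  -- once.
  let g' : BoundedContinuousFunction X ℝ :=
    BoundedContinuousFunction.ofNormedAddCommGroup (fun z => max (-1) (min 1 (g z)))
      (by fun_prop) 1 (fun z => by
        rw [Real.norm_eq_abs, abs_le]
        exact ⟨le_max_left _ _, max_le (by norm_num) (min_le_left _ _)⟩)
  have hg' : ∀ z, |f z - g' z| ≤ ‖f z - g z‖ := by
    intro z
    have h1 : f z = max (-1) (min 1 (f z)) := by
      rw [min_eq_right (abs_le.1 (hf1 z)).2, max_eq_right (abs_le.1 (hf1 z)).1]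
    have h2 : g' z = max (-1) (min 1 (g z)) := rfl
    rw [h2, Real.norm_eq_abs]
    conv_lhs => rw [h1]
    exact (abs_max_sub_max_le_max _ _ _ _).trans
      (max_le (by simp) ((abs_min_sub_min_le_max _ _ _ _).trans (max_le (by simp) le_rfl)))
  have hgi : ∀ (m : Measure X) [IsFiniteMeasure m], Integrable g' m := fun m _ => g'.integrable m
  have hgi' : ∀ (m : Measure X) [IsFiniteMeasure m], Integrable g m := fun m _ => g.integrable m
  have hn : ‖g'‖ ≤ 1 := BoundedContinuousFunction.norm_ofNormedAddCommGroup_le _ zero_le_one _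
  have h1 : ∫ z, g' z ∂m₁ - ∫ z, g' z ∂m₂ ≤ tvDist m₁ m₂ :=
    le_csSup (bddAbove_tvDist m₁ m₂) ⟨g', hn, rfl⟩
  have h2 : ∀ (m : Measure X) [IsFiniteMeasure m],
      |∫ z, f z ∂m - ∫ z, g' z ∂m| ≤ ∫ z, ‖f z - g z‖ ∂m := by
    intro m _
    rw [← integral_sub (hint m) (hgi m)]
    refine (abs_integral_le_integral_abs).trans ?_
    exact integral_mono ((hint m).sub (hgi m)).abs ((hint m).sub (hgi' m)).norm hg'
  have hfg : ∀ (m : Measure X) [IsFiniteMeasure m], Integrable (fun z => ‖f z - g z‖) m :=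
    fun m _ => ((hint m).sub (hgi' m)).norm
  rw [integral_add_measure (hfg m₁) (hfg m₂)] at hg
  have h3 := abs_le.1 (h2 m₁)
  have h4 := abs_le.1 (h2 m₂)
  linarith

theorem tvDist_le [OpensMeasurableSpace X] {m₁ m₂ : Measure X} {C : ℝ}
    (h : ∀ φ : BoundedContinuousFunction X ℝ, ‖φ‖ ≤ 1 → ∫ z, φ z ∂m₁ - ∫ z, φ z ∂m₂ ≤ C) :
    tvDist m₁ m₂ ≤ C := by
  refine csSup_le ⟨0, 0, by simp, by simp⟩ ?_
  rintro r ⟨φ, hφ, rfl⟩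
  exact h φ hφ

theorem tvDist_nonneg [OpensMeasurableSpace X] (m₁ m₂ : Measure X)
    [IsFiniteMeasure m₁] [IsFiniteMeasure m₂] : 0 ≤ tvDist m₁ m₂ :=
  le_csSup (bddAbove_tvDist m₁ m₂) ⟨0, by simp, by simp⟩

/-- If both measures are images under a transition functional with `Q f ≥ α ν(f)` then the total
variation distance contracts by `1 - α`. -/
theorem tvDist_le_of_minorized [NormalSpace X] [BorelSpace X] {m₁ m₂ n₁ n₂ : Measure X}
    [IsProbabilityMeasure m₁] [IsProbabilityMeasure m₂] [IsProbabilityMeasure n₁]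
    [IsProbabilityMeasure n₂] [(m₁ + m₂).WeaklyRegular] {α : ℝ} (hα0 : 0 ≤ α) (hα1 : α < 1)
    (ν : Measure X) [IsProbabilityMeasure ν]
    (Q : (X → ℝ≥0∞) → X → ℝ≥0∞)
    (hQm : ∀ f, Measurable f → Measurable (Q f))
    (hQadd : ∀ f, Measurable f → (∀ z, f z ≤ 1) → ∀ z, Q f z + Q (1 - f) z = 1)
    (hQlow : ∀ f, Measurable f → ∀ z, ENNReal.ofReal α * ∫⁻ y, f y ∂ν ≤ Q f z)
    (h₁ : ∀ f, Measurable f → (∀ z, f z ≤ 1) → ∫⁻ z, f z ∂n₁ = ∫⁻ z, Q f z ∂m₁)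
    (h₂ : ∀ f, Measurable f → (∀ z, f z ≤ 1) → ∫⁻ z, f z ∂n₂ = ∫⁻ z, Q f z ∂m₂) :
    tvDist n₁ n₂ ≤ (1 - α) * tvDist m₁ m₂ := by
  refine tvDist_le fun φ hφ => ?_
  have hφ1 : ∀ z, |φ z| ≤ 1 := fun z => (φ.norm_coe_le_norm z).trans hφ
  -- An affine change to values in [0, 1], where the functional Q applies.
  set f : X → ℝ := fun z => (1 + φ z) / 2 with hfdef
  have hfm : Measurable f := by
    have := φ.continuous.measurable
    fun_prop
  have hf0 : ∀ z, 0 ≤ f z := fun z => by have := (abs_le.1 (hφ1 z)).1; simp only [hfdef]; linarith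
  have hf1 : ∀ z, f z ≤ 1 := fun z => by have := (abs_le.1 (hφ1 z)).2; simp only [hfdef]; linarith
  set F : X → ℝ≥0∞ := fun z => ENNReal.ofReal (f z) with hF
  have hFm : Measurable F := hfm.ennreal_ofReal
  have hF1 : ∀ z, F z ≤ 1 := fun z => ENNReal.ofReal_le_one.2 (hf1 z)
  have hQ1 : ∀ z, Q F z ≤ 1 := fun z => (hQadd F hFm hF1 z) ▸ le_self_add
  set q : X → ℝ := fun z => (Q F z).toReal with hq
  have hqm : Measurable q := (hQm F hFm).ennreal_toReal
  have hQq : ∀ z, Q F z = ENNReal.ofReal (q z) := fun z =>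
    (ENNReal.ofReal_toReal ((hQ1 z).trans_lt ENNReal.one_lt_top).ne).symm
  set c : ℝ := ∫ z, f z ∂ν with hc
  have hfi : ∀ (m : Measure X) [IsFiniteMeasure m], Integrable f m := fun m _ =>
    Integrable.of_bound hfm.aestronglyMeasurable 1
      (Filter.Eventually.of_forall fun z => by
        rw [Real.norm_eq_abs, abs_of_nonneg (hf0 z)]; exact hf1 z)
  have hcF : ∫⁻ z, F z ∂ν = ENNReal.ofReal c :=
    (ofReal_integral_eq_lintegral_ofReal (hfi ν) (Filter.Eventually.of_forall hf0)).symm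
  have hc0 : 0 ≤ c := integral_nonneg hf0
  have hlow : ∀ z, α * c ≤ q z := by
    intro z
    have h := hQlow F hFm z
    rw [hcF, ← ENNReal.ofReal_mul hα0, hQq] at h
    exact (ENNReal.ofReal_le_ofReal_iff ENNReal.toReal_nonneg).1 h
  -- The upper bound is the minorization applied to 1 - f.
  have hupp : ∀ z, q z ≤ 1 - α + α * c := by
    intro z
    have hG : ∀ z, (1 - F) z = ENNReal.ofReal (1 - f z) := by
      intro z
      rw [ENNReal.ofReal_sub _ (hf0 z), ENNReal.ofReal_one]; rfl
    have h := hQlow (1 - F) (measurable_const.sub hFm) z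
    have h1 : ∫⁻ z, (1 - F) z ∂ν = ENNReal.ofReal (1 - c) := by
      simp_rw [hG]
      have hi : Integrable (fun z => 1 - f z) ν := (integrable_const 1).sub (hfi ν)
      rw [← ofReal_integral_eq_lintegral_ofReal hi
        (Filter.Eventually.of_forall fun z => sub_nonneg.2 (hf1 z)),
        integral_sub (integrable_const 1) (hfi ν)]
      simp
      rfl
    have h2 := hQadd F hFm hF1 z
    have h3 : Q F z + ENNReal.ofReal (α * (1 - c)) ≤ 1 := by
      rw [← h2, ENNReal.ofReal_mul hα0, ← h1]; gcongr
    have hc1 : c ≤ 1 := by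
      have := integral_mono (hfi ν) (integrable_const 1) hf1
      simpa using this
    rw [hQq, ← ENNReal.ofReal_add ENNReal.toReal_nonneg
      (mul_nonneg hα0 (sub_nonneg.2 hc1)), ENNReal.ofReal_le_one] at h3
    linarith
  have hqi : ∀ (m : Measure X) [IsFiniteMeasure m], Integrable q m := fun m _ =>
    Integrable.of_bound hqm.aestronglyMeasurable 1
      (Filter.Eventually.of_forall fun z => by
        rw [Real.norm_eq_abs, abs_of_nonneg ENNReal.toReal_nonneg]
        exact ENNReal.toReal_le_of_le_ofReal zero_le_one (by simpa using hQ1 z))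
  have tr : ∀ (n m : Measure X) [IsProbabilityMeasure n] [IsProbabilityMeasure m],
      (∀ f, Measurable f → (∀ z, f z ≤ 1) → ∫⁻ z, f z ∂n = ∫⁻ z, Q f z ∂m) →
      ∫ z, f z ∂n = ∫ z, q z ∂m := by
    intro n m _ _ h
    have h' := h F hFm hF1
    simp_rw [hQq] at h'
    rw [← ofReal_integral_eq_lintegral_ofReal (hqi m)
        (Filter.Eventually.of_forall fun z => ENNReal.toReal_nonneg)] at h'
    rw [hF, ← ofReal_integral_eq_lintegral_ofReal (hfi n) (Filter.Eventually.of_forall hf0)] at h'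
    exact (ENNReal.ofReal_eq_ofReal_iff (integral_nonneg hf0)
      (integral_nonneg fun z => ENNReal.toReal_nonneg)).1 h'
  have hφf : ∀ (n : Measure X) [IsProbabilityMeasure n],
      ∫ z, φ z ∂n = 2 * ∫ z, f z ∂n - 1 := by
    intro n _
    have : ∀ z, φ z = 2 * f z - 1 := fun z => by simp only [hfdef]; ring
    simp_rw [this]
    rw [integral_sub ((hfi n).const_mul 2) (integrable_const 1), integral_const_mul]
    simp
  -- The values of q lie in an interval of length 1 - α; g stretches that interval to [-1, 1]. The
  -- additive constants cancel in the difference of two probability measures, leaving the factor 1 -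
  -- α.
  set g : X → ℝ := fun z => 2 * ((q z - α * c) / (1 - α)) - 1 with hg
  have hα : 0 < 1 - α := sub_pos.2 hα1
  have hgq : ∀ (m : Measure X) [IsProbabilityMeasure m],
      2 * ∫ z, q z ∂m = (1 - α) * ∫ z, g z ∂m + (1 - α + 2 * (α * c)) := by
    intro m _
    have : ∀ z, 2 * q z = (1 - α) * g z + (1 - α + 2 * (α * c)) := by
      intro z; simp only [hg]; field_simp; ring
    rw [← integral_const_mul, ← integral_const_mul]
    simp_rw [this]
    rw [integral_add]
    · simp
    · refine Integrable.const_mul ?_ _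
      exact (((((hqi m).sub (integrable_const _)).div_const _).const_mul 2).sub (integrable_const _))
    · exact integrable_const _
  have hgb : ∀ z, |g z| ≤ 1 := by
    intro z
    have h1 : 0 ≤ (q z - α * c) / (1 - α) := div_nonneg (sub_nonneg.2 (hlow z)) hα.le
    have h2 : (q z - α * c) / (1 - α) ≤ 1 := by
      rw [div_le_one hα]; linarith [hupp z]
    rw [abs_le]
    simp only [hg]
    constructor <;> linarith
  have hfin := integral_sub_le_tvDist m₁ m₂ (f := g) (by fun_prop) hgb
  rw [hφf n₁, hφf n₂, tr n₁ m₁ h₁, tr n₂ m₂ h₂]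
  have e1 := hgq m₁
  have e2 := hgq m₂
  nlinarith [mul_le_mul_of_nonneg_left hfin hα.le]

end TotalVariation

/-! ### The free flow on phase space -/

section Flow

variable {d : ℕ}

theorem toTorus_add (y z : Vel d) : toTorus (y + z) = toTorus y + toTorus z := by
  funext i; simp [toTorus]

theorem toTorus_zero : toTorus (0 : Vel d) = 0 := by
  funext i; simp [toTorus]

theorem continuous_toTorus : Continuous (toTorus : Vel d → Torus d) := by
  refine continuous_pi fun i => ?_
  exact (AddCircle.continuous_mk' (1 : ℝ)).comp (by fun_prop : Continuous fun y : Vel d => y i)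

theorem toTorus_surjective : Function.Surjective (toTorus : Vel d → Torus d) := by
  intro x
  choose y hy using fun i => QuotientAddGroup.mk_surjective (x i)
  exact ⟨WithLp.toLp 2 y, funext fun i => hy i⟩

theorem continuous_flow (V : Set (Vel d)) :
    Continuous fun q : ℝ × Phase V => flow V q.1 q.2 := by
  have := continuous_toTorus (d := d)
  unfold flow
  fun_prop

theorem measurable_flow (V : Set (Vel d)) :
    Measurable fun q : ℝ × Phase V => flow V q.1 q.2 :=
  (continuous_flow V).measurable

theorem measurable_flow_right (V : Set (Vel d)) (t : ℝ) : Measurable (flow V t) :=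
  (measurable_flow V).comp (by fun_prop : Measurable fun z : Phase V => (t, z))

theorem flow_flow (V : Set (Vel d)) (s t : ℝ) (z : Phase V) :
    flow V s (flow V t z) = flow V (s + t) z := by
  unfold flow
  ext1
  · simp only
    rw [add_assoc, ← toTorus_add, add_smul, add_comm (t • _)]
  · rfl

theorem flow_zero (V : Set (Vel d)) (z : Phase V) : flow V 0 z = z := by
  unfold flow; simp [toTorus_zero]

end Flow

/-- The standing assumptions on the velocity space and the collision kernel. -/
structure IsScattering {d : ℕ} (V : Set (Vel d)) (p : V → V → ℝ) (γ : ℝ) : Prop where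
  isOpen : IsOpen V
  isBounded : Bornology.IsBounded V
  nonempty : V.Nonempty
  measurable : Measurable (Function.uncurry p)
  pos : 0 < γ
  lower : ∀ v v' : V, γ / volume.real V ≤ p v v'
  mass : ∀ v' : V, ∫ v, p v v' ∂(leb V) = 1
  equil : ∀ᵐ v ∂(leb V), ∫ v', p v v' ∂(leb V) = 1

/-! ### The scattering and jump kernels, and invariance of ν -/

section Kernels

variable {d : ℕ} {V : Set (Vel d)}

instance : SFinite (leb V) := by
  have : SigmaFinite (leb V) := by
    refine ⟨⟨⟨fun n => Subtype.val ⁻¹' spanningSets (volume : Measure (Vel d)) n,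
      fun _ => trivial, fun n => ?_, ?_⟩⟩⟩
    · unfold leb
      have hm : MeasurableSet (Subtype.val ⁻¹' spanningSets (volume : Measure (Vel d)) n : Set V) :=
        (measurableSet_spanningSets _ n).preimage measurable_subtype_coe
      exact (Measure.comap_apply_le _ _ hm.nullMeasurableSet).trans_lt
        ((measure_mono (image_preimage_subset _ _)).trans_lt (measure_spanningSets_lt_top _ n))
    · rw [← preimage_iUnion, iUnion_spanningSets, preimage_univ]
  infer_instance

theorem leb_univ (hV : IsOpen V) : leb V univ = volume V := by
  unfold leb
  rw [comap_subtype_coe_apply hV.measurableSet]; simp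

theorem isProbabilityMeasure_nuV (hV : IsOpen V) (hb : Bornology.IsBounded V)
    (hne : V.Nonempty) : IsProbabilityMeasure (nuV V) := by
  constructor
  rw [nuV, Measure.smul_apply, leb_univ hV, smul_eq_mul]
  exact ENNReal.inv_mul_cancel (hV.measure_pos _ hne).ne' hb.measure_lt_top.ne

instance : IsProbabilityMeasure (nuX d) := by
  constructor
  unfold nuX
  rw [volume_pi, Measure.pi_univ]
  simp

instance : (nuX d).IsAddRightInvariant := by
  unfold nuX; infer_instance

/-- The kernel `v' ↦ p(v, v') dv`. -/
def scatter (V : Set (Vel d)) (p : V → V → ℝ) : Kernel V V :=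
  Kernel.withDensity (Kernel.const V (leb V)) fun v' v => ENNReal.ofReal (p v v')

/-- The jump kernel of the uniformized process:
`(x, v) ↦ (‖σ‖ - σ(x)) δ_{(x,v)} + σ(x) δ_x ⊗ p(w, v) dw`. -/
def jump (V : Set (Vel d)) (σ : C(Torus d, ℝ)) (p : V → V → ℝ) : Kernel (Phase V) (Phase V) :=
  Kernel.withDensity Kernel.id (fun z _ => ENNReal.ofReal (‖σ‖ - σ z.1)) +
    Kernel.withDensity
      (Kernel.deterministic Prod.fst measurable_fst ×ₖ (scatter V p).comap Prod.snd measurable_snd)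
      (fun z _ => ENNReal.ofReal (σ z.1))

/-- The jump kernel, conjugated by the free flow. -/
def jumpAlong (V : Set (Vel d)) (σ : C(Torus d, ℝ)) (p : V → V → ℝ) :
    Kernel (ℝ × Phase V) (Phase V) :=
  (Kernel.deterministic Prod.fst measurable_fst ×ₖ
    (jump V σ p).comap (fun q : ℝ × Phase V => flow V q.1 q.2) (measurable_flow V)).map
      (fun q : ℝ × Phase V => flow V (-q.1) q.2)

instance (p : V → V → ℝ) : IsSFiniteKernel (scatter V p) := by
  exact Kernel.IsSFiniteKernel.withDensity _ fun _ _ => ENNReal.ofReal_ne_top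

instance (σ : C(Torus d, ℝ)) (p : V → V → ℝ) : IsSFiniteKernel (jump V σ p) := by
  have := Kernel.IsSFiniteKernel.withDensity (Kernel.id : Kernel (Phase V) (Phase V))
    (f := fun z _ => ENNReal.ofReal (‖σ‖ - σ z.1)) fun _ _ => ENNReal.ofReal_ne_top
  have := Kernel.IsSFiniteKernel.withDensity
    (Kernel.deterministic Prod.fst measurable_fst ×ₖ (scatter V p).comap Prod.snd measurable_snd)
    (f := fun (z : Phase V) (_ : Phase V) => ENNReal.ofReal (σ z.1))
    fun _ _ => ENNReal.ofReal_ne_top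
  unfold jump; infer_instance

instance (σ : C(Torus d, ℝ)) (p : V → V → ℝ) : IsSFiniteKernel (jumpAlong V σ p) := by
  unfold jumpAlong; infer_instance

theorem lintegral_scatter {p : V → V → ℝ} (hp : Measurable (Function.uncurry p)) (v : V)
    {f : V → ℝ≥0∞} (hf : Measurable f) :
    ∫⁻ w, f w ∂(scatter V p v) = ∫⁻ w, ENNReal.ofReal (p w v) * f w ∂(leb V) := by
  have hp' : Measurable (Function.uncurry fun (v' v : V) => ENNReal.ofReal (p v v')) :=
    (hp.comp measurable_swap).ennreal_ofReal
  unfold scatter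
  rw [Kernel.lintegral_withDensity _ hp' _ hf]
  simp

theorem lintegral_jump (σ : C(Torus d, ℝ)) (p : V → V → ℝ) (z : Phase V)
    {f : Phase V → ℝ≥0∞} (hf : Measurable f) :
    ∫⁻ y, f y ∂(jump V σ p z) = ENNReal.ofReal (‖σ‖ - σ z.1) * f z +
      ENNReal.ofReal (σ z.1) * ∫⁻ w, f (z.1, w) ∂(scatter V p z.2) := by
  have hσ := σ.continuous.measurable
  have h1 : Measurable (Function.uncurry fun (z : Phase V) (_ : Phase V) =>
      ENNReal.ofReal (‖σ‖ - σ z.1)) := by unfold Function.uncurry; fun_prop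
  have h2 : Measurable (Function.uncurry fun (z : Phase V) (_ : Phase V) =>
      ENNReal.ofReal (σ z.1)) := by unfold Function.uncurry; fun_prop
  unfold jump
  rw [_root_.add_apply, lintegral_add_measure, Kernel.lintegral_withDensity _ h1 _ hf,
    Kernel.lintegral_withDensity _ h2 _ hf, lintegral_const_mul _ hf, lintegral_const_mul _ hf,
    Kernel.id_apply, lintegral_dirac' _ hf, Kernel.lintegral_prod _ _ _ hf,
    Kernel.deterministic_apply, lintegral_dirac']
  · rfl
  · exact hf.lintegral_prod_right'

theorem lintegral_jumpAlong (σ : C(Torus d, ℝ)) (p : V → V → ℝ) (s : ℝ) (z : Phase V)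
    {f : Phase V → ℝ≥0∞} (hf : Measurable f) :
    ∫⁻ y, f y ∂(jumpAlong V σ p (s, z)) =
      ∫⁻ y, f (flow V (-s) y) ∂(jump V σ p (flow V s z)) := by
  have hm : Measurable fun q : ℝ × Phase V => flow V (-q.1) q.2 :=
    (measurable_flow V).comp (by fun_prop : Measurable fun q : ℝ × Phase V => (-q.1, q.2))
  unfold jumpAlong
  have hfm : Measurable fun q : ℝ × Phase V => f (flow V (-q.1) q.2) := hf.comp hm
  rw [Kernel.lintegral_map _ hm _ hf, Kernel.lintegral_prod _ _ _ hfm,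
    Kernel.deterministic_apply, lintegral_dirac']
  · rfl
  · exact (hf.comp hm).lintegral_prod_right'

variable {p : V → V → ℝ} {γ : ℝ}

theorem IsScattering.volume_pos (h : IsScattering V p γ) : 0 < volume.real V :=
  ENNReal.toReal_pos (h.isOpen.measure_pos _ h.nonempty).ne' h.isBounded.measure_lt_top.ne

theorem IsScattering.nonneg (h : IsScattering V p γ) (v w : V) : 0 ≤ p v w :=
  (div_nonneg h.pos.le h.volume_pos.le).trans (h.lower v w)

theorem IsScattering.isFiniteMeasure_leb (h : IsScattering V p γ) : IsFiniteMeasure (leb V) :=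
  ⟨by rw [leb_univ h.isOpen]; exact h.isBounded.measure_lt_top⟩

theorem IsScattering.isProbabilityMeasure_nuV (h : IsScattering V p γ) :
    IsProbabilityMeasure (nuV V) :=
  Boltzmann.isProbabilityMeasure_nuV h.isOpen h.isBounded h.nonempty

theorem IsScattering.isProbabilityMeasure_nu (h : IsScattering V p γ) :
    IsProbabilityMeasure (nu V) := by
  have := h.isProbabilityMeasure_nuV
  unfold nu; infer_instance

theorem IsScattering.scatter_univ (h : IsScattering V p γ) (v : V) : scatter V p v univ = 1 := by
  rw [← lintegral_one, lintegral_scatter h.measurable v measurable_const]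
  simp only [mul_one]
  -- Integrability is implicit in the hypothesis: a non-integrable function has Bochner integral 0,
  -- not 1.
  rw [← ofReal_integral_eq_lintegral_ofReal
    (Integrable.of_integral_ne_zero (by rw [h.mass v]; exact one_ne_zero))
    (Filter.Eventually.of_forall fun w => h.nonneg w v), h.mass v, ENNReal.ofReal_one]

theorem IsScattering.isMarkovKernel_scatter (h : IsScattering V p γ) :
    IsMarkovKernel (scatter V p) :=
  ⟨fun v => ⟨h.scatter_univ v⟩⟩

theorem IsScattering.lintegral_equil (h : IsScattering V p γ) :
    ∀ᵐ w ∂(leb V), ∫⁻ v, ENNReal.ofReal (p w v) ∂(leb V) = 1 := by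
  filter_upwards [h.equil] with w hw
  rw [← ofReal_integral_eq_lintegral_ofReal
    (Integrable.of_integral_ne_zero (by rw [hw]; exact one_ne_zero))
    (Filter.Eventually.of_forall fun v => h.nonneg w v), hw, ENNReal.ofReal_one]

/-- Integrate the pointwise lower bound over V. This is needed to keep the argument of the logarithm
in the rate positive. -/
theorem IsScattering.gamma_le_one (h : IsScattering V p γ) : γ ≤ 1 := by
  obtain ⟨v, hv⟩ := h.nonempty
  have := h.isFiniteMeasure_leb
  have h1 := integral_mono (μ := leb V) (integrable_const (γ / volume.real V))
    (Integrable.of_integral_ne_zero (by rw [h.mass ⟨v, hv⟩]; exact one_ne_zero))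
    (fun w => h.lower w ⟨v, hv⟩)
  rw [h.mass, integral_const, measureReal_def, leb_univ h.isOpen, smul_eq_mul,
    ← measureReal_def, mul_div_cancel₀ _ h.volume_pos.ne'] at h1
  exact h1

variable {σ : C(Torus d, ℝ)}

theorem sub_rate_nonneg (σ : C(Torus d, ℝ)) (x : Torus d) : 0 ≤ ‖σ‖ - σ x :=
  sub_nonneg.2 ((le_abs_self _).trans (σ.norm_coe_le_norm x))

/-- The rate M - σ of fictitious jumps compensates the variable rate σ of true ones. The constant
total rate is the point of uniformization. -/
theorem IsScattering.jump_univ (h : IsScattering V p γ) (hσ : ∀ x, 0 ≤ σ x) (z : Phase V) :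
    jump V σ p z univ = ENNReal.ofReal ‖σ‖ := by
  rw [← lintegral_one, lintegral_jump σ p z measurable_const]
  simp only [lintegral_one, h.scatter_univ, mul_one]
  rw [← ENNReal.ofReal_add (sub_rate_nonneg σ _) (hσ _), sub_add_cancel]

theorem IsScattering.jumpAlong_univ (h : IsScattering V p γ) (hσ : ∀ x, 0 ≤ σ x)
    (q : ℝ × Phase V) : jumpAlong V σ p q univ = ENNReal.ofReal ‖σ‖ := by
  rw [← lintegral_one, ← Prod.mk.eta (p := q), lintegral_jumpAlong σ p _ _ measurable_const,
    lintegral_one, h.jump_univ hσ]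

/-- The free transport preserves `ν`. -/
theorem lintegral_flow_nu [SFinite (nuV V)] (t : ℝ) {f : Phase V → ℝ≥0∞} (hf : Measurable f) :
    ∫⁻ z, f (flow V t z) ∂(nu V) = ∫⁻ z, f z ∂(nu V) := by
  unfold nu
  have hft : Measurable fun z => f (flow V t z) := hf.comp (measurable_flow_right V t)
  rw [lintegral_prod_symm' _ hft, lintegral_prod_symm' _ hf]
  refine lintegral_congr fun v => ?_
  exact lintegral_add_right_eq_self (μ := nuX d) (fun x => f (x, v)) (toTorus (t • (v : Vel d)))

theorem lintegral_nuV (f : V → ℝ≥0∞) :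
    ∫⁻ v, f v ∂(nuV V) = (volume V)⁻¹ * ∫⁻ v, f v ∂(leb V) := by
  unfold nuV
  rw [lintegral_smul_measure, smul_eq_mul]

/-- After Tonelli the integral over the incoming velocity is 1 for a.e. outgoing one; this is the
equilibrium hypothesis on p. -/
theorem IsScattering.lintegral_scatter_nuV (h : IsScattering V p γ) {f : V → ℝ≥0∞}
    (hf : Measurable f) :
    ∫⁻ v, ∫⁻ w, f w ∂(scatter V p v) ∂(nuV V) = ∫⁻ w, f w ∂(nuV V) := by
  have hp : Measurable fun q : V × V => ENNReal.ofReal (p q.2 q.1) * f q.2 :=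
    (h.measurable.comp measurable_swap).ennreal_ofReal.mul (hf.comp measurable_snd)
  rw [lintegral_nuV, lintegral_nuV]
  congr 1
  simp_rw [lintegral_scatter h.measurable _ hf]
  rw [lintegral_lintegral_swap hp.aemeasurable]
  refine lintegral_congr_ae ?_
  filter_upwards [h.lintegral_equil] with w hw
  rw [lintegral_mul_const, hw, one_mul]
  exact (h.measurable.comp (by fun_prop : Measurable fun v : V => (w, v))).ennreal_ofReal

theorem IsScattering.lintegral_jump_nu (h : IsScattering V p γ) (hσ : ∀ x, 0 ≤ σ x)
    {f : Phase V → ℝ≥0∞} (hf : Measurable f) :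
    ∫⁻ z, ∫⁻ y, f y ∂(jump V σ p z) ∂(nu V) = ENNReal.ofReal ‖σ‖ * ∫⁻ z, f z ∂(nu V) := by
  have := h.isProbabilityMeasure_nuV
  have hm : Measurable fun z : Phase V => ∫⁻ y, f y ∂(jump V σ p z) := hf.lintegral_kernel
  unfold nu
  rw [lintegral_prod _ hm.aemeasurable, lintegral_prod _ hf.aemeasurable, ← lintegral_const_mul]
  · refine lintegral_congr fun x => ?_
    have hfx : Measurable fun v => f (x, v) := hf.comp (by fun_prop)
    simp_rw [lintegral_jump σ p _ hf]
    rw [lintegral_add_left (hfx.const_mul _), lintegral_const_mul _ hfx,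
      lintegral_const_mul _ hfx.lintegral_kernel, h.lintegral_scatter_nuV hfx, ← add_mul,
      ← ENNReal.ofReal_add (sub_rate_nonneg σ _) (hσ _), sub_add_cancel]
  · exact hf.lintegral_prod_right'

end Kernels

/-! ### Solutions in the moving frame, and time translation -/

section Pulled

variable {d : ℕ} {V : Set (Vel d)}

/-- The curve `s ↦ e^{Ms} T_{-s} μ_{a+s}`. -/
def pulled (M a : ℝ) (μ : Kernel ℝ (Phase V)) : Kernel ℝ (Phase V) :=
  Kernel.withDensity
    ((Kernel.deterministic id measurable_id ×ₖ
      μ.comap (fun s => a + s) (by fun_prop : Measurable fun s : ℝ => a + s)).map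
      (fun q : ℝ × Phase V => flow V (-q.1) q.2))
    (fun s _ => ENNReal.ofReal (Real.exp (M * s)))

instance (M a : ℝ) (μ : Kernel ℝ (Phase V)) [IsSFiniteKernel μ] :
    IsSFiniteKernel (pulled M a μ) := by
  exact Kernel.IsSFiniteKernel.withDensity _ fun _ _ => ENNReal.ofReal_ne_top

theorem lintegral_pulled (M a : ℝ) (μ : Kernel ℝ (Phase V)) [IsSFiniteKernel μ] (s : ℝ)
    {f : Phase V → ℝ≥0∞} (hf : Measurable f) :
    ∫⁻ z, f z ∂(pulled M a μ s) =
      ENNReal.ofReal (Real.exp (M * s)) * ∫⁻ z, f (flow V (-s) z) ∂(μ (a + s)) := by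
  have hm : Measurable fun q : ℝ × Phase V => flow V (-q.1) q.2 :=
    (measurable_flow V).comp (by fun_prop : Measurable fun q : ℝ × Phase V => (-q.1, q.2))
  have h1 : Measurable (Function.uncurry fun (s : ℝ) (_ : Phase V) =>
      ENNReal.ofReal (Real.exp (M * s))) := by unfold Function.uncurry; fun_prop
  have hfm : Measurable fun q : ℝ × Phase V => f (flow V (-q.1) q.2) := hf.comp hm
  unfold pulled
  rw [Kernel.lintegral_withDensity _ h1 _ hf, lintegral_const_mul _ hf,
    Kernel.lintegral_map _ hm _ hf, Kernel.lintegral_prod _ _ _ hfm,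
    Kernel.deterministic_apply, lintegral_dirac']
  · rfl
  · exact (hf.comp hm).lintegral_prod_right'

/-- The integral form of the equation, started at time `a`. -/
def IsMild (σ : C(Torus d, ℝ)) (p : V → V → ℝ) (a : ℝ) (μ : Kernel ℝ (Phase V)) : Prop :=
  ∀ t, 0 ≤ t → IsIntegralSolution (jumpAlong V σ p) t (pulled ‖σ‖ a μ)

/-- The equation is autonomous: moving the origin of time to a conjugates it by the flow for time a
and multiplies it by the constant e^{‖σ‖a}, which is finite and nonzero and can be cancelled. -/
theorem IsMild.shift {σ : C(Torus d, ℝ)} {p : V → V → ℝ} {μ : Kernel ℝ (Phase V)}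
    [IsMarkovKernel μ] (h : IsMild σ p 0 μ) {a : ℝ} (ha : 0 ≤ a) : IsMild σ p a μ := by
  intro t ht s hs f hf
  have hfa : Measurable fun z => f (flow V a z) := hf.comp (measurable_flow_right V a)
  set c := ENNReal.ofReal (Real.exp (‖σ‖ * a)) with hc
  have hc0 : c ≠ 0 := by simp [hc, Real.exp_pos]
  have hct : c ≠ ∞ := ENNReal.ofReal_ne_top
  -- conjugation of the time shift
  have e1 : ∀ (r : ℝ) (g : Phase V → ℝ≥0∞), Measurable g →
      ∫⁻ z, g (flow V a z) ∂(pulled ‖σ‖ 0 μ (a + r)) = c * ∫⁻ z, g z ∂(pulled ‖σ‖ a μ r) := by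
    intro r g hg
    have hga : Measurable fun z => g (flow V a z) := hg.comp (measurable_flow_right V a)
    rw [lintegral_pulled _ _ _ _ hg, lintegral_pulled _ _ _ _ hga, ← mul_assoc, hc,
      ← ENNReal.ofReal_mul (Real.exp_pos _).le, ← Real.exp_add, zero_add, ← mul_add]
    simp only [flow_flow]
    congr 3
    ext z
    congr 2
    ring
  have e2 : ∀ (r : ℝ) (z : Phase V), ∫⁻ y, f (flow V a y) ∂(jumpAlong V σ p (a + r, z))
      = ∫⁻ y, f y ∂(jumpAlong V σ p (r, flow V a z)) := by
    intro r z
    rw [lintegral_jumpAlong _ _ _ _ hfa, lintegral_jumpAlong _ _ _ _ hf]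
    simp only [flow_flow, add_comm r a]
    congr 1
    ext z
    congr 2
    ring
  have e3 : ∀ r, Measurable fun z => ∫⁻ y, f y ∂(jumpAlong V σ p (r, z)) := fun r =>
    (hf.lintegral_kernel (κ := jumpAlong V σ p)).comp (by fun_prop : Measurable fun z => (r, z))
  have hs1 := h (a + s) (add_nonneg ha hs.1) (a + s) ⟨add_nonneg ha hs.1, le_rfl⟩ _ hfa
  have ha1 := h (a + s) (add_nonneg ha hs.1) a ⟨ha, le_add_of_nonneg_right hs.1⟩ _ hfa
  -- Extended nonnegative numbers do not allow subtracting the equations at times a + s and a.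
  -- Instead the integral up to a is reassembled, with the initial term, into the solution at time
  -- a.
  have hun : Ioc 0 (a + s) = Ioc 0 a ∪ Ioc a (a + s) :=
    (Ioc_union_Ioc_eq_Ioc ha (le_add_of_nonneg_right hs.1)).symm
  rw [hun, lintegral_union measurableSet_Ioc (Ioc_disjoint_Ioc_of_le le_rfl), ← add_assoc,
    ← ha1, e1 s f hf] at hs1
  have ha2 := e1 0 f hf
  rw [add_zero] at ha2
  have hint : ∫⁻ q in Ioc a (a + s),
        ∫⁻ z, ∫⁻ y, f (flow V a y) ∂(jumpAlong V σ p (q, z)) ∂(pulled ‖σ‖ 0 μ q)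
      = c * ∫⁻ q in Ioc 0 s, ∫⁻ z, ∫⁻ y, f y ∂(jumpAlong V σ p (q, z)) ∂(pulled ‖σ‖ a μ q) := by
    have h1 : Ioc 0 s = (fun q => a + q) ⁻¹' (Ioc a (a + s)) := by
      ext q; simp
    rw [h1, ← lintegral_const_mul' _ _ hct,
      ← (measurePreserving_add_left volume a).setLIntegral_comp_preimage_emb
        (MeasurableEquiv.addLeft a).measurableEmbedding]
    simp_rw [e2]
    refine lintegral_congr fun q => ?_
    exact e1 q _ (e3 q)
  rw [ha2, hint, ← mul_add] at hs1
  exact (ENNReal.mul_right_inj hc0 hct).1 hs1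

end Pulled

/-! ### Stationarity of ν -/

section Equilibrium

variable {d : ℕ} {V : Set (Vel d)} {p : V → V → ℝ} {γ : ℝ} {σ : C(Torus d, ℝ)}

theorem lintegral_exp_mul {M : ℝ} (hM : 0 ≤ M) {s : ℝ} (hs : 0 ≤ s) :
    1 + ∫⁻ q in Ioc 0 s, ENNReal.ofReal (M * Real.exp (M * q))
      = ENNReal.ofReal (Real.exp (M * s)) := by
  rw [← ofReal_integral_eq_lintegral_ofReal
      ((Continuous.integrableOn_Icc (by fun_prop)).mono_set Ioc_subset_Icc_self)
      (Filter.Eventually.of_forall fun q => mul_nonneg hM (Real.exp_pos _).le),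
    ← intervalIntegral.integral_of_le hs]
  have hd : ∀ q ∈ uIcc 0 s, HasDerivAt (fun q => Real.exp (M * q)) (M * Real.exp (M * q)) q := by
    intro q _
    have := ((hasDerivAt_id q).const_mul M).exp
    refine this.congr_deriv ?_
    simp [mul_comm]
  rw [intervalIntegral.integral_eq_sub_of_hasDerivAt hd
    (Continuous.intervalIntegrable (by fun_prop) _ _), ← ENNReal.ofReal_one, ← ENNReal.ofReal_add]
  · simp
  · exact zero_le_one
  · simp only [mul_zero, Real.exp_zero, sub_nonneg, Real.one_le_exp_iff]; positivity

/-- The flow preserves ν and the jump kernel multiplies it by ‖σ‖, so the equation reduces to the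
scalar identity e^{Ms} = 1 + ∫_0^s M e^{Mq} dq. -/
theorem IsScattering.isMild_nu (h : IsScattering V p γ) (hσ : ∀ x, 0 ≤ σ x) (a : ℝ) :
    IsMild σ p a (Kernel.const ℝ (nu V)) := by
  have := h.isProbabilityMeasure_nuV
  have := h.isProbabilityMeasure_nu
  intro t ht s hs f hf
  have e : ∀ (r : ℝ) (g : Phase V → ℝ≥0∞), Measurable g →
      ∫⁻ z, g z ∂(pulled ‖σ‖ a (Kernel.const ℝ (nu V)) r)
        = ENNReal.ofReal (Real.exp (‖σ‖ * r)) * ∫⁻ z, g z ∂(nu V) := by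
    intro r g hg
    rw [lintegral_pulled _ _ _ _ hg, Kernel.const_apply, lintegral_flow_nu _ hg]
  have e3 : ∀ r, Measurable fun z => ∫⁻ y, f y ∂(jumpAlong V σ p (r, z)) := fun r =>
    (hf.lintegral_kernel (κ := jumpAlong V σ p)).comp (by fun_prop : Measurable fun z => (r, z))
  have e4 : ∀ r, ∫⁻ z, ∫⁻ y, f y ∂(jumpAlong V σ p (r, z)) ∂(nu V)
      = ENNReal.ofReal ‖σ‖ * ∫⁻ z, f z ∂(nu V) := by
    intro r
    have hfr : Measurable fun z => f (flow V (-r) z) := hf.comp (measurable_flow_right V _)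
    simp_rw [lintegral_jumpAlong _ _ _ _ hf]
    rw [lintegral_flow_nu r (f := fun z => ∫⁻ y, f (flow V (-r) y) ∂(jump V σ p z))
      hfr.lintegral_kernel, h.lintegral_jump_nu hσ hfr, lintegral_flow_nu _ hf]
  rw [e s f hf, e 0 f hf]
  simp_rw [e _ _ (e3 _), e4, ← mul_assoc]
  rw [lintegral_mul_const _ (by fun_prop), mul_zero, Real.exp_zero, ENNReal.ofReal_one, ← add_mul,
    ← lintegral_exp_mul (norm_nonneg σ) hs.1]
  congr 3
  funext q
  rw [← ENNReal.ofReal_mul (Real.exp_pos _).le, mul_comm]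

end Equilibrium

/-! ### The two-collision lower bound -/

section Minorization

variable {d : ℕ} {V : Set (Vel d)} {p : V → V → ℝ} {γ : ℝ} {σ : C(Torus d, ℝ)}

theorem IsScattering.le_lintegral_scatter (h : IsScattering V p γ) (v : V) {f : V → ℝ≥0∞}
    (hf : Measurable f) :
    ENNReal.ofReal γ * ∫⁻ w, f w ∂(nuV V) ≤ ∫⁻ w, f w ∂(scatter V p v) := by
  have e : (volume V)⁻¹ = ENNReal.ofReal (1 / volume.real V) := by
    rw [one_div, ENNReal.ofReal_inv_of_pos h.volume_pos, measureReal_def,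
      ENNReal.ofReal_toReal h.isBounded.measure_lt_top.ne]
  rw [lintegral_scatter h.measurable v hf, lintegral_nuV, ← mul_assoc, e,
    ← ENNReal.ofReal_mul h.pos.le, ← lintegral_const_mul _ hf]
  refine lintegral_mono fun w => ?_
  gcongr
  rw [mul_one_div]
  exact h.lower w v

/-- The fictitious jumps are dropped, and in a true collision p is replaced by its lower bound, so
the outgoing velocity no longer depends on the incoming one. -/
theorem IsScattering.le_lintegral_jumpAlong (h : IsScattering V p γ) (hσ : ∀ x, 0 ≤ σ x)
    (s : ℝ) (z : Phase V) {f : Phase V → ℝ≥0∞} (hf : Measurable f) :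
    ENNReal.ofReal (γ * σ (flow V s z).1) *
        ∫⁻ w, f (flow V (-s) ((flow V s z).1, w)) ∂(nuV V)
      ≤ ∫⁻ y, f y ∂(jumpAlong V σ p (s, z)) := by
  have hfs : Measurable fun z => f (flow V (-s) z) := hf.comp (measurable_flow_right V _)
  rw [lintegral_jumpAlong σ p s z hf, lintegral_jump σ p _ hfs]
  refine le_trans ?_ le_add_self
  rw [mul_comm γ, ENNReal.ofReal_mul (hσ _), mul_assoc]
  gcongr
  exact h.le_lintegral_scatter _ (hfs.comp (by fun_prop : Measurable fun w => ((flow V s z).1, w)))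

theorem SpreadsMass.le_lintegral [SFinite (nuV V)] {Ts β : ℝ} (h : SpreadsMass V Ts β) {t : ℝ}
    (ht : Ts ≤ t) (x : Torus d) {f : Torus d → ℝ≥0∞} (hf : Measurable f) :
    ENNReal.ofReal β * ∫⁻ y, f y ∂(nuX d)
      ≤ ∫⁻ w : V, f (x + toTorus (t • (w : Vel d))) ∂(nuV V) := by
  have h1 := lintegral_mono' (h.2.2 t ht x) (le_refl f)
  rw [lintegral_smul_measure, smul_eq_mul, transport, lintegral_map hf measurable_fst] at h1
  have hf1 : Measurable fun z : Phase V => f z.1 := hf.comp measurable_fst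
  have hf2 : Measurable fun z : Phase V => f (flow V t z).1 := hf1.comp (measurable_flow_right V t)
  rw [lintegral_map hf1 (measurable_flow_right V t), lintegral_prod _ hf2.aemeasurable,
    lintegral_dirac'] at h1
  · exact h1
  · exact hf2.lintegral_prod_right'

theorem GCC.le_lintegral {T κ : ℝ} (h : GCC V σ T κ) (hσ : ∀ x, 0 ≤ σ x) (z : Phase V) :
    ENNReal.ofReal κ ≤ ∫⁻ s in Ioc 0 T, ENNReal.ofReal (σ (flow V s z).1) := by
  have hc : Continuous fun s : ℝ => σ (flow V s z).1 :=
    σ.continuous.comp (continuous_fst.comp ((continuous_flow V).comp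
      (by fun_prop : Continuous fun s : ℝ => (s, z))))
  rw [← ofReal_integral_eq_lintegral_ofReal (hc.integrableOn_Icc.mono_set Ioc_subset_Icc_self)
    (Filter.Eventually.of_forall fun s => hσ _), ← intervalIntegral.integral_of_le h.1.le]
  exact ENNReal.ofReal_le_ofReal (h.2.2 z.1 z.2)

/-- The geometric control condition backwards in time. -/
theorem GCC.le_lintegral_backward {T κ : ℝ} (h : GCC V σ T κ) (hσ : ∀ x, 0 ≤ σ x) (t : ℝ)
    (z : Phase V) :
    ENNReal.ofReal κ ≤ ∫⁻ s in Ioc (t - T) t, ENNReal.ofReal (σ (flow V (-(t - s)) z).1) := by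
  -- The forward condition, started a time T earlier on the trajectory that ends at z.
  have h1 := h.le_lintegral hσ (flow V (-T) z)
  have h2 : Ioc 0 T = (fun s => (t - T) + s) ⁻¹' Ioc (t - T) t := by
    ext s
    simp only [mem_Ioc, mem_preimage]
    constructor <;> rintro ⟨h1, h2⟩ <;> constructor <;> linarith
  rw [← (measurePreserving_add_left volume (t - T)).setLIntegral_comp_preimage_emb
    (MeasurableEquiv.addLeft (t - T)).measurableEmbedding, ← h2]
  refine h1.trans_eq (lintegral_congr fun s => ?_)
  rw [flow_flow]
  congr 4
  ring

/-- The density of a collision at `x`, followed by free flight for a time `u`. -/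
def collide (V : Set (Vel d)) (σ : C(Torus d, ℝ)) (γ : ℝ) (g : Phase V → ℝ≥0∞)
    (u : ℝ) (x : Torus d) : ℝ≥0∞ :=
  ENNReal.ofReal (γ * σ x) * ∫⁻ w, g (flow V u (x, w)) ∂(nuV V)

theorem measurable_collide [SFinite (nuV V)] {g : Phase V → ℝ≥0∞} (hg : Measurable g) :
    Measurable fun q : ℝ × Torus d => collide V σ γ g q.1 q.2 := by
  have hσm := σ.continuous.measurable
  have h1 : Measurable fun q : (ℝ × Torus d) × V => g (flow V q.1.1 (q.1.2, q.2)) :=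
    hg.comp ((measurable_flow V).comp
      (by fun_prop : Measurable fun q : (ℝ × Torus d) × V => (q.1.1, (q.1.2, q.2))))
  have h3 : Measurable fun q : ℝ × Torus d => ENNReal.ofReal (γ * σ q.2) := by fun_prop
  exact h3.mul h1.lintegral_prod_right'

theorem measurable_rate_flow (V : Set (Vel d)) (σ : C(Torus d, ℝ)) (γ : ℝ) :
    Measurable fun q : ℝ × Phase V => ENNReal.ofReal (γ * σ (flow V q.1 q.2).1) :=
  ((σ.continuous.measurable.comp (measurable_fst.comp (measurable_flow V))).const_mul
    γ).ennreal_ofReal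

/-- Change variables by the ν-preserving flow: the collision point becomes the position reached by
tracing the end point back for a time u. -/
theorem lintegral_collide [SFinite (nuV V)] {g : Phase V → ℝ≥0∞} (hg : Measurable g) (u : ℝ) :
    ∫⁻ x, collide V σ γ g u x ∂(nuX d)
      = ∫⁻ y, ENNReal.ofReal (γ * σ (flow V (-u) y).1) * g y ∂(nu V) := by
  have hk : Measurable fun y : Phase V => ENNReal.ofReal (γ * σ (flow V (-u) y).1) * g y :=
    ((measurable_rate_flow V σ γ).comp (by fun_prop : Measurable fun y : Phase V => (-u, y))).mul hg
  have hgu : Measurable fun y => g (flow V u y) := hg.comp (measurable_flow_right V u)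
  have hk' : Measurable fun y : Phase V => ENNReal.ofReal (γ * σ y.1) * g (flow V u y) :=
    ((σ.continuous.measurable.comp measurable_fst).const_mul γ).ennreal_ofReal.mul hgu
  rw [← lintegral_flow_nu u hk]
  have e : ∀ y, ENNReal.ofReal (γ * σ (flow V (-u) (flow V u y)).1) * g (flow V u y)
      = ENNReal.ofReal (γ * σ y.1) * g (flow V u y) := by
    intro y
    rw [flow_flow, neg_add_cancel, flow_zero]
  rw [lintegral_congr e, nu, lintegral_prod _ hk'.aemeasurable]
  refine lintegral_congr fun x => ?_
  unfold collide
  have hgx : Measurable fun w : V => g (flow V u (x, w)) :=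
    hgu.comp (by fun_prop : Measurable fun w : V => (x, w))
  exact (lintegral_const_mul (μ := nuV V) (ENNReal.ofReal (γ * σ x)) hgx).symm

/-- After Tonelli, each end point y carries the integral of σ along its own backward trajectory over
the last window, which geometric control bounds below by κ. -/
theorem GCC.le_lintegral_collide [SFinite (nuV V)] {T κ : ℝ} (hc : GCC V σ T κ)
    (hσ : ∀ x, 0 ≤ σ x) (hγ : 0 ≤ γ) (t : ℝ) {g : Phase V → ℝ≥0∞} (hg : Measurable g) :
    ENNReal.ofReal (γ * κ) * ∫⁻ y, g y ∂(nu V)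
      ≤ ∫⁻ s in Ioc (t - T) t, ∫⁻ x, collide V σ γ g (t - s) x ∂(nuX d) := by
  have : SFinite (nu V) := by unfold nu; infer_instance
  have hk : Measurable fun q : ℝ × Phase V =>
      ENNReal.ofReal (γ * σ (flow V (-(t - q.1)) q.2).1) := by
    have hu : Measurable fun q : ℝ × Phase V => (-(t - q.1), q.2) := by fun_prop
    have := (measurable_rate_flow V σ γ).comp hu
    exact this
  have hkg : Measurable fun q : ℝ × Phase V =>
      ENNReal.ofReal (γ * σ (flow V (-(t - q.1)) q.2).1) * g q.2 :=
    hk.mul (hg.comp measurable_snd)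
  simp_rw [lintegral_collide hg]
  rw [lintegral_lintegral_swap hkg.aemeasurable, ← lintegral_const_mul _ hg]
  refine lintegral_mono fun y => ?_
  have hks : Measurable fun s : ℝ => ENNReal.ofReal (γ * σ (flow V (-(t - s)) y).1) := by
    have hu : Measurable fun s : ℝ => (s, y) := by fun_prop
    have := hk.comp hu
    exact this
  rw [lintegral_mul_const _ hks]
  gcongr
  simp_rw [ENNReal.ofReal_mul hγ]
  rw [lintegral_const_mul' _ _ ENNReal.ofReal_ne_top]
  gcongr
  exact hc.le_lintegral_backward hσ t y

theorem IsScattering.le_volterra (h : IsScattering V p γ) (hσ : ∀ x, 0 ≤ σ x) {g : Phase V → ℝ≥0∞}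
    (hg : Measurable g) {t T r : ℝ} (hr : r ≤ t - T) (y : Phase V) :
    ∫⁻ s in Ioc (t - T) t, collide V σ γ g (t - s) (flow V s y).1
      ≤ volterra (jumpAlong V σ p) t (fun q => g (flow V t q.2)) (r, y) := by
  simp only [volterra]
  refine le_trans ?_ (lintegral_mono_set (s := Ioc (t - T) t) (Ioc_subset_Ioc_left hr))
  refine lintegral_mono fun s => ?_
  have hgt : Measurable fun y => g (flow V t y) := hg.comp (measurable_flow_right V t)
  refine le_trans (le_of_eq ?_) (h.le_lintegral_jumpAlong hσ s y hgt)
  simp only [collide, flow_flow, ← sub_eq_add_neg]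

/-- Collide at r in (0, T] and again at s in (t - T, t]. The first collision makes the velocity
uniform, the flight between them spreads the position by (H), and the second collision makes the
velocity uniform again. Geometric control along the initial trajectory handles the integral over r;
along the final one, the integral over s. No exponential loss appears, because the Dyson series is
taken with the weight e^{‖σ‖s}. -/
theorem IsScattering.minorization (h : IsScattering V p γ) (hσ : ∀ x, 0 ≤ σ x) {Ts β T κ : ℝ}
    (hs : SpreadsMass V Ts β) (hc : GCC V σ T κ) {g : Phase V → ℝ≥0∞} (hg : Measurable g)
    (z : Phase V) :
    ENNReal.ofReal (β * γ ^ 2 * κ ^ 2) * ∫⁻ y, g y ∂(nu V)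
      ≤ dyson (jumpAlong V σ p) (2 * T + Ts) (fun y => g (flow V (2 * T + Ts) y)) z := by
  have := h.isProbabilityMeasure_nuV
  set t := 2 * T + Ts with ht
  have hT := hc.1
  have hTs := hs.1
  have hσm := σ.continuous.measurable
  have hΦm : Measurable fun q : ℝ × Torus d => collide V σ γ g q.1 q.2 := measurable_collide hg
  set c : ℝ≥0∞ := ENNReal.ofReal β * (ENNReal.ofReal (γ * κ) * ∫⁻ y, g y ∂(nu V)) with hcdef
  have hF : Measurable fun q : ℝ × Phase V => g (flow V t q.2) :=
    hg.comp ((measurable_flow_right V t).comp measurable_snd)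
  have first : ∀ r ∈ Ioc 0 T, ENNReal.ofReal (γ * σ (flow V r z).1) * c ≤
      ∫⁻ y, volterra (jumpAlong V σ p) t (fun q => g (flow V t q.2)) (r, y)
        ∂(jumpAlong V σ p (r, z)) := by
    intro r hr
    have hrt : r ≤ t - T := by have := hr.2; linarith
    have hvm : Measurable fun y =>
        volterra (jumpAlong V σ p) t (fun q => g (flow V t q.2)) (r, y) :=
      (measurable_volterra _ t hF).comp (by fun_prop : Measurable fun y : Phase V => (r, y))
    refine le_trans ?_ (h.le_lintegral_jumpAlong hσ r z hvm)
    gcongr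
    set x₁ := (flow V r z).1
    have hΦw : Measurable fun q : V × ℝ =>
        collide V σ γ g (t - q.2) (x₁ + toTorus ((q.2 - r) • (q.1 : Vel d))) := by
      have hu : Measurable fun q : V × ℝ =>
          (t - q.2, x₁ + toTorus ((q.2 - r) • (q.1 : Vel d))) := by
        have := (continuous_toTorus (d := d)).measurable
        fun_prop
      have := hΦm.comp hu
      exact this
    calc c ≤ ENNReal.ofReal β *
            ∫⁻ s in Ioc (t - T) t, ∫⁻ x, collide V σ γ g (t - s) x ∂(nuX d) := by
          rw [hcdef]; gcongr; exact hc.le_lintegral_collide hσ h.pos.le t hg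
      _ = ∫⁻ s in Ioc (t - T) t, ENNReal.ofReal β * ∫⁻ x, collide V σ γ g (t - s) x ∂(nuX d) :=
          (lintegral_const_mul' _ _ ENNReal.ofReal_ne_top).symm
      _ ≤ ∫⁻ s in Ioc (t - T) t,
            ∫⁻ w : V, collide V σ γ g (t - s) (x₁ + toTorus ((s - r) • (w : Vel d))) ∂(nuV V) := by
          refine setLIntegral_mono' measurableSet_Ioc fun s hs' => ?_
          -- Since s > t - T and r ≤ T, the flight lasts longer than t - 2T = T_*; this is why the
          -- period is 2T + T_*.
          have hle : Ts ≤ s - r := by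
            have := hs'.1; have := hr.2; linarith
          have hu : Measurable fun x : Torus d => (t - s, x) := by fun_prop
          have hΦs := hΦm.comp hu
          exact hs.le_lintegral hle x₁ hΦs
      _ = ∫⁻ w : V, (∫⁻ s in Ioc (t - T) t,
            collide V σ γ g (t - s) (x₁ + toTorus ((s - r) • (w : Vel d)))) ∂(nuV V) :=
          (lintegral_lintegral_swap hΦw.aemeasurable).symm
      _ ≤ _ := by
          refine lintegral_mono fun w => ?_
          refine le_trans (le_of_eq ?_) (h.le_volterra hσ hg hrt _)
          refine lintegral_congr fun s => ?_
          rw [flow_flow, ← sub_eq_add_neg]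
          rfl
  have hm : Measurable fun r : ℝ => ENNReal.ofReal (γ * σ (flow V r z).1) := by
    have hu : Measurable fun r : ℝ => (r, z) := by fun_prop
    have := (measurable_rate_flow V σ γ).comp hu
    exact this
  calc ENNReal.ofReal (β * γ ^ 2 * κ ^ 2) * ∫⁻ y, g y ∂(nu V) = ENNReal.ofReal (γ * κ) * c := by
        have hβ := hs.2.1.1
        have hκ := hc.2.1
        have hγ := h.pos
        rw [hcdef, ← mul_assoc, ← mul_assoc, ← ENNReal.ofReal_mul (by positivity),
          ← ENNReal.ofReal_mul (by positivity)]
        congr 2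
        ring
    _ ≤ ∫⁻ r in Ioc 0 T, ENNReal.ofReal (γ * σ (flow V r z).1) * c := by
        rw [lintegral_mul_const _ hm]
        gcongr
        simp_rw [ENNReal.ofReal_mul h.pos.le]
        rw [lintegral_const_mul' _ _ ENNReal.ofReal_ne_top]
        gcongr
        exact hc.le_lintegral hσ z
    _ ≤ ∫⁻ r in Ioc 0 T,
          ∫⁻ y, volterra (jumpAlong V σ p) t (fun q => g (flow V t q.2)) (r, y)
            ∂(jumpAlong V σ p (r, z)) := setLIntegral_mono' measurableSet_Ioc first
    _ ≤ (volterra (jumpAlong V σ p) t)^[2] (fun q => g (flow V t q.2)) (0, z) := by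
        rw [Function.iterate_succ_apply', Function.iterate_one]
        conv_rhs => rw [volterra]
        exact lintegral_mono_set (Ioc_subset_Ioc_right (by linarith))
    -- All other terms of the series are nonnegative and are discarded.
    _ ≤ _ := ENNReal.le_tsum 2

end Minorization

/-! ### Contraction for solutions of the integral equation -/

section Contraction

variable {d : ℕ} {V : Set (Vel d)} {p : V → V → ℝ} {γ : ℝ} {σ : C(Torus d, ℝ)}

/-- Two solutions at time `t`, started at time `a`, are closer than at time `a` by a factor
`1 - α` whenever the propagator is minorized by `α e^{‖σ‖ t} ν`. -/
theorem IsMild.tvDist_le (h : IsScattering V p γ) (hσ : ∀ x, 0 ≤ σ x)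
    {μ μ' : Kernel ℝ (Phase V)} [IsMarkovKernel μ] [IsMarkovKernel μ'] {a t : ℝ} (ht : 0 ≤ t)
    (hμ : IsMild σ p a μ) (hμ' : IsMild σ p a μ') {α : ℝ} (hα0 : 0 ≤ α) (hα1 : α < 1)
    (hlow : ∀ g : Phase V → ℝ≥0∞, Measurable g → ∀ z,
      ENNReal.ofReal (α * Real.exp (‖σ‖ * t)) * ∫⁻ y, g y ∂(nu V)
        ≤ dyson (jumpAlong V σ p) t (fun y => g (flow V t y)) z) :
    tvDist (μ (a + t)) (μ' (a + t)) ≤ (1 - α) * tvDist (μ a) (μ' a) := by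
  have := h.isProbabilityMeasure_nu
  set c := ENNReal.ofReal (Real.exp (‖σ‖ * t)) with hc
  have hc0 : c ≠ 0 := by simp [hc, Real.exp_pos]
  have hct : c ≠ ∞ := ENNReal.ofReal_ne_top
  have hcc : c⁻¹ * c = 1 := ENNReal.inv_mul_cancel hc0 hct
  have hft : ∀ f : Phase V → ℝ≥0∞, Measurable f → Measurable fun y => f (flow V t y) :=
    fun f hf => hf.comp (measurable_flow_right V t)
  -- Composing f with the flow for time t returns from the moving frame to the fixed one, and c⁻¹
  -- removes the exponential weight. The resulting functional is the same for every solution.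
  have key : ∀ (m : Kernel ℝ (Phase V)) [IsMarkovKernel m], IsMild σ p a m →
      ∀ f : Phase V → ℝ≥0∞, Measurable f → (∀ z, f z ≤ 1) → ∫⁻ z, f z ∂(m (a + t))
        = ∫⁻ z, c⁻¹ * dyson (jumpAlong V σ p) t (fun y => f (flow V t y)) z ∂(m a) := by
    intro m _ hm f hf hf1
    have hu : ∀ s, pulled ‖σ‖ a m s univ = ENNReal.ofReal (Real.exp (‖σ‖ * s)) := by
      intro s
      rw [← lintegral_one, lintegral_pulled _ _ _ _ measurable_const]
      simp
    have hfin : IsFiniteMeasure (pulled ‖σ‖ a m 0) := ⟨by rw [hu]; exact ENNReal.ofReal_lt_top⟩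
    have e := (hm t ht).lintegral_eq ht (norm_nonneg σ) (h.jumpAlong_univ hσ)
      (by rw [hu, hu]; simp) (hft f hf) (fun z => hf1 _)
    have hd := measurable_dyson (jumpAlong V σ p) t (hft f hf)
    rw [lintegral_pulled _ _ _ _ (hft f hf), lintegral_pulled _ _ _ _ hd] at e
    simp only [flow_flow, add_neg_cancel, flow_zero, neg_zero, mul_zero, Real.exp_zero,
      ENNReal.ofReal_one, one_mul, add_zero, ← hc] at e
    rw [lintegral_const_mul _ hd, ← e, ← mul_assoc, hcc, one_mul]
  refine tvDist_le_of_minorized hα0 hα1 (nu V)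
    (fun f z => c⁻¹ * dyson (jumpAlong V σ p) t (fun y => f (flow V t y)) z)
    (fun f hf => (measurable_dyson _ t (hft f hf)).const_mul _) ?_ ?_ (key μ hμ) (key μ' hμ')
  · intro f hf hf1 z
    rw [← mul_add, ← dyson_add _ t (hft f hf)]
    have e : ((fun y => f (flow V t y)) + fun y => (1 - f) (flow V t y)) = fun _ => 1 := by
      funext y; exact add_tsub_cancel_of_le (hf1 _)
    rw [e, dyson_one _ (norm_nonneg σ) (h.jumpAlong_univ hσ) ht, ← hc, hcc]
  · intro f hf z
    have := hlow f hf z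
    rw [ENNReal.ofReal_mul hα0, ← hc] at this
    calc ENNReal.ofReal α * ∫⁻ y, f y ∂(nu V)
        = c⁻¹ * (ENNReal.ofReal α * c * ∫⁻ y, f y ∂(nu V)) := by
          rw [mul_comm _ c, ← mul_assoc, ← mul_assoc, hcc, one_mul]
      _ ≤ _ := by gcongr

end Contraction

/-! ### Smooth test functions determine finite measures on phase space -/

section Separation

variable {d : ℕ} {V : Set (Vel d)}

/-- Time-independent test functions, `C¹` and compactly supported in `V`. -/
structure IsPhaseTest (V : Set (Vel d)) (ψ : Torus d → Vel d → ℝ) : Prop where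
  contDiff : ContDiff ℝ 1 fun q : Vel d × Vel d => ψ (toTorus q.1) q.2
  support : ∃ K ⊆ V, IsCompact K ∧ ∀ x, ∀ v ∉ K, ψ x v = 0

theorem contDiff_mFourier (k : Fin d → ℤ) :
    ContDiff ℝ 1 fun y : Vel d => UnitAddTorus.mFourier k (toTorus y) := by
  have : (fun y : Vel d => UnitAddTorus.mFourier k (toTorus y))
      = fun y : Vel d => ∏ i, Complex.exp (2 * Real.pi * Complex.I * k i * (y i : ℂ) / (1 : ℝ)) := by
    funext y
    change ∏ i, fourier (k i) ((y i : ℝ) : AddCircle (1 : ℝ)) = _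
    exact Finset.prod_congr rfl fun i _ => fourier_coe_apply
  rw [this]
  refine contDiff_prod fun i _ => ?_
  have h : ContDiff ℝ 1 fun y : Vel d => ((y i : ℝ) : ℂ) :=
    Complex.ofRealCLM.contDiff.comp (contDiff_piLp_apply (p := 2))
  exact ((contDiff_const.mul h).div_const _).cexp

/-- Integrals of `a(x) b(v)` agree for all continuous `a`. -/
theorem integral_mul_eq_of_isPhaseTest {m₁ m₂ : Measure (Phase V)} [IsFiniteMeasure m₁]
    [IsFiniteMeasure m₂]
    (h : ∀ ψ, IsPhaseTest V ψ → ∫ z, ψ z.1 z.2 ∂m₁ = ∫ z, ψ z.1 z.2 ∂m₂)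
    {b : Vel d → ℝ} (hb : ContDiff ℝ 1 b) {C : ℝ} (hbC : ∀ v, |b v| ≤ C)
    (hbs : ∃ K ⊆ V, IsCompact K ∧ ∀ v ∉ K, b v = 0) (a : C(Torus d, ℂ)) :
    ∫ z, a z.1 * (b z.2 : ℂ) ∂m₁ = ∫ z, a z.1 * (b z.2 : ℂ) ∂m₂ := by
  have hbc := hb.continuous
  have hint : ∀ (m : Measure (Phase V)) [IsFiniteMeasure m] (a : C(Torus d, ℂ)),
      Integrable (fun z : Phase V => a z.1 * (b z.2 : ℂ)) m := by
    intro m _ a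
    refine Integrable.of_bound (by fun_prop) (‖a‖ * C) (Filter.Eventually.of_forall fun z => ?_)
    rw [norm_mul, Complex.norm_real]
    exact mul_le_mul (a.norm_coe_le_norm _) (hbC _) (norm_nonneg _) (norm_nonneg _)
  -- The functions a for which the integrals agree form a closed complex subspace. It contains the
  -- characters, whose span is dense in C(𝕋^d).
  let S : Submodule ℂ C(Torus d, ℂ) :=
    { carrier := {a | ∫ z, a z.1 * (b z.2 : ℂ) ∂m₁ = ∫ z, a z.1 * (b z.2 : ℂ) ∂m₂}
      add_mem' := by
        intro a a' h h'
        simp only [mem_ofPred_eq, ContinuousMap.add_apply, add_mul] at *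
        rw [integral_add (hint m₁ a) (hint m₁ a'), integral_add (hint m₂ a) (hint m₂ a'), h, h']
      zero_mem' := by simp
      smul_mem' := by
        intro c a h
        simp only [mem_ofPred_eq, ContinuousMap.smul_apply, smul_eq_mul, mul_assoc] at *
        rw [integral_const_mul, integral_const_mul, h] }
  have hcont : ∀ (m : Measure (Phase V)) [IsFiniteMeasure m],
      Continuous fun a : C(Torus d, ℂ) => ∫ z, a z.1 * (b z.2 : ℂ) ∂m := by
    intro m _
    refine continuous_iff_continuousAt.2 fun a => ?_
    rw [ContinuousAt, tendsto_iff_norm_sub_tendsto_zero]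
    have hlim : Filter.Tendsto (fun a' : C(Torus d, ℂ) => ‖a' - a‖ * C * m.real univ)
        (nhds a) (nhds 0) := by
      have : Continuous fun a' : C(Torus d, ℂ) => ‖a' - a‖ * C * m.real univ := by fun_prop
      simpa using this.tendsto a
    refine squeeze_zero (fun _ => norm_nonneg _) (fun a' => ?_) hlim
    rw [← integral_sub (hint m a') (hint m a)]
    refine norm_integral_le_of_norm_le_const (Filter.Eventually.of_forall fun z => ?_)
    rw [← sub_mul, norm_mul, Complex.norm_real]
    exact mul_le_mul ((a' - a).norm_coe_le_norm _) (hbC _) (norm_nonneg _) (norm_nonneg _)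
  have hclosed : IsClosed (S : Set C(Torus d, ℂ)) := isClosed_eq (hcont m₁) (hcont m₂)
  have hspan : Submodule.span ℂ (range (UnitAddTorus.mFourier (d := Fin d))) ≤ S := by
    rw [Submodule.span_le]
    rintro _ ⟨k, rfl⟩
    -- Test functions are real-valued, so a character is tested through its real and imaginary
    -- parts.
    have hre : IsPhaseTest V fun x v => (UnitAddTorus.mFourier k x).re * b v := by
      refine ⟨?_, ?_⟩
      · have h1 : ContDiff ℝ 1 fun y : Vel d => (UnitAddTorus.mFourier k (toTorus y)).re :=
          Complex.reCLM.contDiff.comp (contDiff_mFourier k)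
        exact (h1.comp contDiff_fst).mul (hb.comp contDiff_snd)
      · obtain ⟨K, hK, hKc, h0⟩ := hbs
        exact ⟨K, hK, hKc, fun x v hv => by simp [h0 v hv]⟩
    have him : IsPhaseTest V fun x v => (UnitAddTorus.mFourier k x).im * b v := by
      refine ⟨?_, ?_⟩
      · have h1 : ContDiff ℝ 1 fun y : Vel d => (UnitAddTorus.mFourier k (toTorus y)).im :=
          Complex.imCLM.contDiff.comp (contDiff_mFourier k)
        exact (h1.comp contDiff_fst).mul (hb.comp contDiff_snd)
      · obtain ⟨K, hK, hKc, h0⟩ := hbs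
        exact ⟨K, hK, hKc, fun x v hv => by simp [h0 v hv]⟩
    change ∫ z, _ ∂m₁ = ∫ z, _ ∂m₂
    apply Complex.ext
    · have e : ∀ (m : Measure (Phase V)) [IsFiniteMeasure m],
          (∫ z, UnitAddTorus.mFourier k z.1 * (b z.2 : ℂ) ∂m).re
            = ∫ z, (UnitAddTorus.mFourier k z.1).re * b z.2 ∂m := by
        intro m _
        have := integral_re (hint m (UnitAddTorus.mFourier k))
        simp only [RCLike.re_eq_complex_re, Complex.mul_re, Complex.ofReal_re, Complex.ofReal_im,
          mul_zero, sub_zero] at this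
        exact this.symm
      rw [e m₁, e m₂]
      exact h _ hre
    · have e : ∀ (m : Measure (Phase V)) [IsFiniteMeasure m],
          (∫ z, UnitAddTorus.mFourier k z.1 * (b z.2 : ℂ) ∂m).im
            = ∫ z, (UnitAddTorus.mFourier k z.1).im * b z.2 ∂m := by
        intro m _
        have := integral_im (hint m (UnitAddTorus.mFourier k))
        simp only [RCLike.im_eq_complex_im, Complex.mul_im, Complex.ofReal_re, Complex.ofReal_im,
          mul_zero, zero_add] at this
        exact this.symm
      rw [e m₁, e m₂]
      exact h _ him
  have htop := Submodule.topologicalClosure_minimal _ hspan hclosed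
  rw [UnitAddTorus.span_mFourier_closure_eq_top] at htop
  exact htop (Submodule.mem_top (x := a))

/-- An open subset of a bounded set is the increasing limit of smooth functions with compact
support. -/
theorem exists_contDiff_tendsto_indicator {W : Set (Vel d)} (hW : IsOpen W)
    (hb : Bornology.IsBounded W) :
    ∃ b : ℕ → Vel d → ℝ, (∀ n, ContDiff ℝ 1 (b n)) ∧ (∀ n v, |b n v| ≤ 1) ∧
      (∀ n, ∃ K ⊆ W, IsCompact K ∧ ∀ v ∉ K, b n v = 0) ∧
      ∀ v, Filter.Tendsto (fun n => b n v) Filter.atTop (nhds (W.indicator 1 v)) := by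
  obtain ⟨f, hfs, hf, hf1⟩ := hW.exists_contDiff_support_eq (n := 1)
  have hf0 : ∀ v, 0 ≤ f v := fun v => (hf1 (mem_range_self v)).1
  -- Here f ≥ 0 is smooth and vanishes exactly off W. The composite is 0 where nf ≤ 1 and 1 where nf
  -- ≥ 2; the shift by 1 puts its support in the compact set {nf ≥ 1}, inside W.
  refine ⟨fun n v => Real.smoothTransition (n * f v - 1), fun n => ?_, fun n v => ?_, fun n => ?_,
    fun v => ?_⟩
  · have : ContDiff ℝ 1 Real.smoothTransition := Real.smoothTransition.contDiff (n := 1)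
    exact this.comp ((contDiff_const.mul hf).sub contDiff_const)
  · rw [abs_of_nonneg (Real.smoothTransition.nonneg _)]
    exact Real.smoothTransition.le_one _
  · have hKW : {v | 1 ≤ n * f v} ⊆ W := by
      intro v hv
      rw [← hfs, Function.mem_support]
      rintro h0
      simp only [mem_ofPred_eq, h0, mul_zero] at hv
      linarith
    refine ⟨{v | 1 ≤ n * f v}, hKW, ?_, fun v hv => ?_⟩
    · refine Metric.isCompact_of_isClosed_isBounded ?_ (hb.subset hKW)
      exact isClosed_le continuous_const (continuous_const.mul hf.continuous)
    · simp only [mem_ofPred_eq, not_le] at hv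
      exact Real.smoothTransition.zero_of_nonpos (by linarith)
  · by_cases hv : v ∈ W
    · rw [indicator_of_mem hv]
      have hpos : 0 < f v := (hf0 v).lt_of_ne' (by rw [← hfs] at hv; exact hv)
      refine tendsto_const_nhds.congr' ?_
      obtain ⟨N, hN⟩ := exists_nat_ge (2 / f v)
      filter_upwards [Filter.eventually_ge_atTop N] with n hn
      refine (Real.smoothTransition.one_of_one_le ?_).symm
      have h1 : 2 / f v ≤ n := hN.trans (by exact_mod_cast hn)
      rw [div_le_iff₀ hpos] at h1
      linarith
    · rw [indicator_of_notMem hv]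
      have h0 : f v = 0 := by rw [← hfs, Function.mem_support, not_not] at hv; exact hv
      refine tendsto_const_nhds.congr fun n => ?_
      exact (Real.smoothTransition.zero_of_nonpos (by rw [h0]; norm_num)).symm

/-- Test functions separate finite measures on the phase space. -/
theorem ext_of_isPhaseTest (hV : IsOpen V) (hVb : Bornology.IsBounded V)
    {m₁ m₂ : Measure (Phase V)} [IsFiniteMeasure m₁] [IsFiniteMeasure m₂]
    (h : ∀ ψ, IsPhaseTest V ψ → ∫ z, ψ z.1 z.2 ∂m₁ = ∫ z, ψ z.1 z.2 ∂m₂) : m₁ = m₂ := by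
  -- rectangles with an open base in `V`
  have hrect : ∀ (A : Set (Torus d)) (W : Set V), MeasurableSet A → IsOpen W →
      m₁ (A ×ˢ W) = m₂ (A ×ˢ W) := by
    intro A W hA hW
    obtain ⟨U, hU, rfl⟩ := isOpen_induced_iff.1 hW
    have hWm : MeasurableSet (Prod.snd ⁻¹' (Subtype.val ⁻¹' U) : Set (Phase V)) :=
      hW.measurableSet.preimage measurable_snd
    obtain ⟨b, hb, hb1, hbs, hbl⟩ := exists_contDiff_tendsto_indicator (hU.inter hV)
      (hVb.subset inter_subset_right)
    have key : ∀ a : BoundedContinuousFunction (Torus d) ℝ,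
        ∫ x, a x ∂((m₁.restrict (Prod.snd ⁻¹' (Subtype.val ⁻¹' U))).map Prod.fst)
          = ∫ x, a x ∂((m₂.restrict (Prod.snd ⁻¹' (Subtype.val ⁻¹' U))).map Prod.fst) := by
      intro a
      have hae : ∀ (m : Measure (Phase V)) [IsFiniteMeasure m],
          Filter.Tendsto (fun n => ∫ z, a z.1 * b n z.2 ∂m) Filter.atTop
            (nhds (∫ x, a x ∂((m.restrict (Prod.snd ⁻¹' (Subtype.val ⁻¹' U))).map Prod.fst))) := by
        intro m _
        rw [integral_map measurable_fst.aemeasurable a.continuous.aestronglyMeasurable,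
          ← integral_indicator hWm]
        refine tendsto_integral_of_dominated_convergence (fun _ => ‖a‖) (fun n => ?_)
          (integrable_const _) (fun n => ?_) ?_
        · have := (hb n).continuous
          have := a.continuous
          exact Continuous.aestronglyMeasurable (by fun_prop)
        · refine Filter.Eventually.of_forall fun z => ?_
          rw [norm_mul]
          exact (mul_le_mul (a.norm_coe_le_norm _) (hb1 n _) (abs_nonneg _)
            (norm_nonneg _)).trans_eq (mul_one _)
        · refine Filter.Eventually.of_forall fun z => ?_
          have := (hbl z.2).const_mul (a z.1)
          convert this using 2
          by_cases hz : (z.2 : Vel d) ∈ U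
          · have hz' : z ∈ (Prod.snd ⁻¹' (Subtype.val ⁻¹' U) : Set (Phase V)) := hz
            have hz2 : (z.2 : Vel d) ∈ U ∩ V := ⟨hz, z.2.2⟩
            rw [indicator_of_mem hz', indicator_of_mem hz2]
            simp
          · have hz' : z ∉ (Prod.snd ⁻¹' (Subtype.val ⁻¹' U) : Set (Phase V)) := hz
            rw [indicator_of_notMem hz', indicator_of_notMem fun h => hz h.1, mul_zero]
      refine tendsto_nhds_unique ((hae m₁).congr fun n => ?_) (hae m₂)
      have hC := integral_mul_eq_of_isPhaseTest h (hb n) (hb1 n)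
        (by obtain ⟨K, hK, hK'⟩ := hbs n; exact ⟨K, hK.trans inter_subset_right, hK'⟩)
        ⟨fun x => (a x : ℂ), Complex.continuous_ofReal.comp a.continuous⟩
      simp only [ContinuousMap.coe_mk, ← Complex.ofReal_mul, integral_complex_ofReal] at hC
      exact Complex.ofReal_injective hC
    have hm := ext_of_forall_integral_eq_of_IsFiniteMeasure key
    have hmA := congrArg (fun m => m A) hm
    simp only [Measure.map_apply measurable_fst hA,
      Measure.restrict_apply (hA.preimage measurable_fst)] at hmA
    rwa [prod_eq]
  -- For fixed A both sides are finite measures in B, so agreement on the π-system of open sets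
  -- suffices.
  refine Measure.ext_prod fun {A B} hA hB => ?_
  have hfib : ∀ (m : Measure (Phase V)) [IsFiniteMeasure m] (B : Set V), MeasurableSet B →
      ((m.restrict (Prod.fst ⁻¹' A)).map Prod.snd) B = m (A ×ˢ B) := by
    intro m _ B hB
    rw [Measure.map_apply measurable_snd hB, Measure.restrict_apply (hB.preimage measurable_snd),
      inter_comm, prod_eq]
  rw [← hfib m₁ B hB, ← hfib m₂ B hB]
  congr 1
  refine ext_of_generate_finite _ (BorelSpace.measurable_eq) isPiSystem_isOpen ?_ ?_
  · intro W hW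
    have hWo : IsOpen W := hW
    rw [hfib m₁ W hWo.measurableSet, hfib m₂ W hWo.measurableSet]
    exact hrect A W hA hWo
  · rw [hfib m₁ univ MeasurableSet.univ, hfib m₂ univ MeasurableSet.univ]
    exact hrect A univ hA isOpen_univ

end Separation

/-! ### Weak derivatives in time -/

section DuBoisReymond

/-- A cut-off primitive of a smooth function supported in `(0, τ)`. -/
theorem exists_cutoff_primitive {τ : ℝ} (hτ : 0 < τ) {g : ℝ → ℝ} (hg : ContDiff ℝ 1 g)
    (hgc : HasCompactSupport g) (hgs : tsupport g ⊆ Ioo 0 τ) :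
    ∃ χ : ℝ → ℝ, ContDiff ℝ 1 χ ∧ HasCompactSupport χ ∧ tsupport χ ⊆ Iio τ ∧
      ∀ t, 0 ≤ t → χ t = ∫ s in t..τ, g s := by
  -- The primitive that vanishes at τ already vanishes from b on, which keeps the support strictly
  -- to the left of τ.
  obtain ⟨b, hb0, hbτ, hb⟩ : ∃ b, 0 ≤ b ∧ b < τ ∧ ∀ t ∈ tsupport g, t ≤ b := by
    rcases (tsupport g).eq_empty_or_nonempty with h | h
    · exact ⟨0, le_rfl, hτ, by simp [h]⟩
    · obtain ⟨b, hb⟩ := IsCompact.exists_isGreatest hgc h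
      exact ⟨b, (hgs hb.1).1.le, (hgs hb.1).2, fun t ht => hb.2 ht⟩
  have hg0 : ∀ t, b < t → g t = 0 := fun t ht =>
    image_eq_zero_of_notMem_tsupport fun h => not_lt.2 (hb t h) ht
  have hP0 : ∀ t, b ≤ t → ∫ s in t..τ, g s = 0 := by
    intro t ht
    refine intervalIntegral.integral_zero_ae (Filter.Eventually.of_forall fun s hs => hg0 s ?_)
    rw [uIoc, mem_Ioc] at hs
    exact (le_min ht hbτ.le).trans_lt hs.1
  have hP : ∀ t, HasDerivAt (fun t => ∫ s in t..τ, g s) (-g t) t := fun t =>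
    intervalIntegral.integral_hasDerivAt_left (hg.continuous.intervalIntegrable _ _)
      (hg.continuous.stronglyMeasurableAtFilter _ _) hg.continuous.continuousAt
  have hPc : ContDiff ℝ 1 fun t => ∫ s in t..τ, g s := by
    rw [contDiff_one_iff_deriv]
    refine ⟨fun t => (hP t).differentiableAt, ?_⟩
    have : deriv (fun t => ∫ s in t..τ, g s) = fun t => -g t := funext fun t => (hP t).deriv
    rw [this]
    exact hg.continuous.neg
  have hs0 : ∀ t ∉ Icc (-1) b, Real.smoothTransition (t + 1) * ∫ s in t..τ, g s = 0 := by
    intro t ht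
    rw [mem_Icc, not_and_or, not_le, not_le] at ht
    rcases ht with ht | ht
    · rw [Real.smoothTransition.zero_of_nonpos (by linarith), zero_mul]
    · rw [hP0 t ht.le, mul_zero]
  -- To the left of the support of g the primitive is the constant ∫g; the factor, 0 for t ≤ -1 and
  -- 1 for t ≥ 0, cuts it off without changing it on [0, τ].
  refine ⟨fun t => Real.smoothTransition (t + 1) * ∫ s in t..τ, g s, ?_, ?_, ?_, ?_⟩
  · have : ContDiff ℝ 1 Real.smoothTransition := Real.smoothTransition.contDiff (n := 1)
    exact (this.comp (contDiff_id.add contDiff_const)).mul hPc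
  · exact HasCompactSupport.intro isCompact_Icc hs0
  · refine (closure_minimal ?_ isClosed_Icc).trans
      (fun t (ht : t ∈ Icc (-1) b) => ht.2.trans_lt hbτ)
    intro t ht
    by_contra h
    exact ht (hs0 t h)
  · intro t ht
    change Real.smoothTransition (t + 1) * _ = _
    rw [Real.smoothTransition.one_of_one_le (by linarith), one_mul]

/-- A continuous function whose weak derivative is `H` is a primitive of `H`. -/
theorem eq_add_integral_of_weak {G H : ℝ → ℝ} {c τ : ℝ} (hτ : 0 < τ)
    (hG : ContinuousOn G (Icc 0 τ)) (hH : IntervalIntegrable H volume 0 τ)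
    (h : ∀ χ : ℝ → ℝ, ContDiff ℝ 1 χ → HasCompactSupport χ → tsupport χ ⊆ Iio τ →
      ∫ t in (0 : ℝ)..τ, (deriv χ t * G t + χ t * H t) = -(χ 0 * c)) :
    ∀ t ∈ Icc 0 τ, G t = c + ∫ s in (0 : ℝ)..t, H s := by
  set F : ℝ → ℝ := fun t => ∫ s in (0 : ℝ)..t, H s with hF
  have huIcc : uIcc 0 τ = Icc 0 τ := uIcc_of_le hτ.le
  have hFac : AbsolutelyContinuousOnInterval F 0 τ :=
    hH.absolutelyContinuousOnInterval_intervalIntegral left_mem_uIcc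
  have hFc : ContinuousOn F (Icc 0 τ) := huIcc ▸ hFac.continuousOn
  have hDc : ContinuousOn (fun t => G t - (c + F t)) (Icc 0 τ) :=
    hG.sub (continuousOn_const.add hFc)
  -- Test the hypothesis with the χ satisfying χ' = -g on (0, τ) and χ(τ) = 0, and integrate χH by
  -- parts. The boundary value χ(0) = ∫g produces the constant c.
  have hweak : ∀ g : ℝ → ℝ, ContDiff ℝ ((⊤ : ℕ∞) : WithTop ℕ∞) g →
      HasCompactSupport g → tsupport g ⊆ Ioo 0 τ →
      ∫ t, g t • (G t - (c + F t)) = 0 := by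
    intro g hg hgc hgs
    obtain ⟨χ, hχ, hχc, hχs, hχP⟩ :=
      exists_cutoff_primitive hτ (hg.of_le (by exact_mod_cast le_top)) hgc hgs
    have hgi : ∀ a b, IntervalIntegrable g volume a b := hg.continuous.intervalIntegrable
    have hχac : AbsolutelyContinuousOnInterval χ 0 τ :=
      hχ.contDiffOn.absolutelyContinuousOnInterval
    have hχd : ∀ t ∈ Ioo 0 τ, deriv χ t = -g t := by
      intro t ht
      have h1 : HasDerivAt (fun t => ∫ s in t..τ, g s) (-g t) t :=
        intervalIntegral.integral_hasDerivAt_left (hgi _ _)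
          (hg.continuous.stronglyMeasurableAtFilter _ _) hg.continuous.continuousAt
      refine (h1.congr_of_eventuallyEq ?_).deriv
      filter_upwards [lt_mem_nhds ht.1] with s hs using hχP s hs.le
    have hχτ : χ τ = 0 := by rw [hχP τ hτ.le, intervalIntegral.integral_same]
    have hF0 : F 0 = 0 := intervalIntegral.integral_same
    have hparts := hχac.integral_deriv_mul_eq_sub hFac
    rw [hχτ, hF0, zero_mul, mul_zero, sub_zero] at hparts
    have hae : ∀ᵐ t, t ∈ uIoc 0 τ → t ∈ Ioo 0 τ := by
      have : ∀ᵐ t : ℝ, t ≠ τ := by simp [ae_iff, measure_singleton]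
      filter_upwards [this] with t ht ht'
      rw [uIoc_of_le hτ.le] at ht'
      exact ⟨ht'.1, lt_of_le_of_ne ht'.2 ht⟩
    have e1 : ∫ t in (0 : ℝ)..τ, (deriv χ t * F t + χ t * deriv F t)
        = ∫ t in (0 : ℝ)..τ, (-(g t * F t) + χ t * H t) := by
      refine intervalIntegral.integral_congr_ae ?_
      filter_upwards [hae, hH.ae_hasDerivAt_integral] with t ht hFt ht'
      have h1 := ht ht'
      rw [hχd t h1, (hFt (huIcc ▸ Ioo_subset_Icc_self h1) 0 left_mem_uIcc).deriv, neg_mul]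
    have e2 : ∫ t in (0 : ℝ)..τ, (deriv χ t * G t + χ t * H t)
        = ∫ t in (0 : ℝ)..τ, (-(g t * G t) + χ t * H t) := by
      refine intervalIntegral.integral_congr_ae ?_
      filter_upwards [hae] with t ht ht'
      rw [hχd t (ht ht'), neg_mul]
    have hw := h χ hχ hχc hχs
    rw [e1] at hparts
    rw [e2] at hw
    have iG : IntervalIntegrable (fun t => g t * G t) volume 0 τ :=
      (hg.continuous.continuousOn.mul (huIcc ▸ hG)).intervalIntegrable
    have iF : IntervalIntegrable (fun t => g t * F t) volume 0 τ :=
      (hg.continuous.continuousOn.mul (huIcc ▸ hFc)).intervalIntegrable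
    have iH : IntervalIntegrable (fun t => χ t * H t) volume 0 τ :=
      hH.continuousOn_mul hχ.continuous.continuousOn
    have iFn : IntervalIntegrable (fun t => -(g t * F t)) volume 0 τ := iF.neg
    have iGn : IntervalIntegrable (fun t => -(g t * G t)) volume 0 τ := iG.neg
    rw [intervalIntegral.integral_add iFn iH, intervalIntegral.integral_neg] at hparts
    rw [intervalIntegral.integral_add iGn iH, intervalIntegral.integral_neg, hχP 0 le_rfl] at hw
    have e3 : ∫ t, g t • (G t - (c + F t))
        = ∫ t in (0 : ℝ)..τ, (g t * G t - (g t * F t + g t * c)) := by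
      rw [intervalIntegral.integral_of_le hτ.le, ← integral_indicator measurableSet_Ioc]
      refine integral_congr_ae (Filter.Eventually.of_forall fun t => ?_)
      by_cases ht : t ∈ Ioc 0 τ
      · simp only [indicator_of_mem ht, smul_eq_mul]; ring
      · have h0 : g t = 0 := image_eq_zero_of_notMem_tsupport fun h' =>
          ht (Ioo_subset_Ioc_self (hgs h'))
        simp only [indicator_of_notMem ht, h0, zero_smul]
    rw [e3, intervalIntegral.integral_sub iG (iF.add ((hgi _ _).mul_const c)),
      intervalIntegral.integral_add iF ((hgi _ _).mul_const c), intervalIntegral.integral_mul_const]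
    linarith
  have hloc : LocallyIntegrableOn (fun t => G t - (c + F t)) (Ioo 0 τ) volume :=
    (hDc.mono Ioo_subset_Icc_self).locallyIntegrableOn measurableSet_Ioo
  have hae := isOpen_Ioo.ae_eq_zero_of_integral_contDiff_smul_eq_zero hloc hweak
  have hae' : (fun t => G t - (c + F t)) =ᵐ[volume.restrict (Icc 0 τ)] fun _ => 0 := by
    rw [← restrict_Ioo_eq_restrict_Icc]
    exact (ae_restrict_iff' measurableSet_Ioo).2 hae
  intro t ht
  -- Continuity upgrades almost everywhere to everywhere, end points included; the value at 0 is
  -- what identifies the initial datum.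
  have := Measure.eqOn_Icc_of_ae_eq volume hτ.ne hae' hDc continuousOn_const ht
  simp only at this
  linarith

end DuBoisReymond

/-! ### Weakly continuous curves of probability measures -/

section WeakContinuity

variable {X : Type*} [TopologicalSpace X] [MeasurableSpace X] [BorelSpace X]

/-- The mass of a closed set is a limit of integrals of bounded continuous functions, each
continuous in t, and closed sets form a generating π-system. -/
theorem measurable_coe_of_continuous [HasOuterApproxClosed X] {μ : ℝ → ProbabilityMeasure X}
    (hμ : Continuous μ) : Measurable fun t => (μ t : Measure X) := by
  refine Measurable.measure_of_isPiSystem_of_isProbabilityMeasure (S := {s | IsClosed s})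
    (borel_eq_generateFrom_isClosed (α := X) ▸ BorelSpace.measurable_eq) isPiSystem_isClosed ?_
  intro F hF
  have hF' : IsClosed F := hF
  have hlim : ∀ t, Filter.Tendsto
      (fun n => ((μ t).toFiniteMeasure.testAgainstNN (hF'.apprSeq n) : ℝ≥0∞))
      Filter.atTop (nhds ((μ t : Measure X) F)) := by
    intro t
    simp only [FiniteMeasure.testAgainstNN_coe_eq]
    exact HasOuterApproxClosed.tendsto_lintegral_apprSeq hF' (μ t : Measure X)
  refine measurable_of_tendsto_metrizable (fun n => ?_) (tendsto_pi_nhds.2 hlim)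
  have := (ProbabilityMeasure.continuous_testAgainstNN_eval (hF'.apprSeq n)).comp hμ
  exact (ENNReal.continuous_coe.comp this).measurable

/-- Joint continuity of `t ↦ ∫ f_t dμ_t`. -/
theorem continuous_integral_of_compact {μ : ℝ → ProbabilityMeasure X} (hμ : Continuous μ)
    {f : ℝ → X → ℝ} (hf : Continuous (Function.uncurry f)) {K : Set X} (hK : IsCompact K)
    (hfK : ∀ t, ∀ z ∉ K, f t z = 0) : Continuous fun t => ∫ z, f t z ∂(μ t : Measure X) := by
  have hb : ∀ t, ∃ C, ∀ z, ‖f t z‖ ≤ C := by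
    intro t
    have hft : Continuous (f t) := hf.comp (by fun_prop : Continuous fun z : X => (t, z))
    obtain ⟨C, hC⟩ := hK.exists_bound_of_continuousOn hft.continuousOn
    refine ⟨max C 0, fun z => ?_⟩
    by_cases hz : z ∈ K
    · exact (hC z hz).trans (le_max_left _ _)
    · rw [hfK t z hz, norm_zero]; exact le_max_right _ _
  choose C hC using hb
  let Ψ : ℝ → BoundedContinuousFunction X ℝ := fun t =>
    BoundedContinuousFunction.ofNormedAddCommGroup (f t)
      (hf.comp (by fun_prop : Continuous fun z : X => (t, z))) (C t) (hC t)
  have hint : ∀ t (m : ProbabilityMeasure X), Integrable (f t) (m : Measure X) := fun t m =>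
    (Ψ t).integrable _
  refine continuous_iff_continuousAt.2 fun t₀ => ?_
  rw [Metric.continuousAt_iff']
  intro ε hε
  -- Compactness makes f_t close to f_{t₀} uniformly on K; weak continuity then only has to handle
  -- the fixed function f_{t₀}.
  obtain ⟨v, hv, hv'⟩ := hK.mem_uniformity_of_prod (f := f) (s := univ) (q := t₀)
    hf.continuousOn (mem_univ _) (Metric.dist_mem_uniformity (half_pos hε))
  rw [nhdsWithin_univ] at hv
  have hw : Filter.Tendsto (fun t => ∫ z, Ψ t₀ z ∂(μ t : Measure X)) (nhds t₀)
      (nhds (∫ z, Ψ t₀ z ∂(μ t₀ : Measure X))) :=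
    (ProbabilityMeasure.tendsto_iff_forall_integral_tendsto.1 hμ.continuousAt) (Ψ t₀)
  filter_upwards [hv, Metric.tendsto_nhds.1 hw _ (half_pos hε)] with t ht ht'
  have h1 : dist (∫ z, f t z ∂(μ t : Measure X)) (∫ z, f t₀ z ∂(μ t : Measure X)) ≤ ε / 2 := by
    rw [dist_eq_norm, ← integral_sub (hint t _) (hint t₀ _)]
    have := norm_integral_le_of_norm_le_const (μ := (μ t : Measure X))
      (f := fun z => f t z - f t₀ z) (C := ε / 2) (Filter.Eventually.of_forall fun z => ?_)
    · simpa using this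
    · by_cases hz : z ∈ K
      · rw [← dist_eq_norm]; exact (hv' t ht z hz).le
      · rw [hfK t z hz, hfK t₀ z hz]; rw [sub_zero, norm_zero]; exact (half_pos hε).le
  calc _ ≤ _ := dist_triangle _ (∫ z, f t₀ z ∂(μ t : Measure X)) _
    _ < ε / 2 + ε / 2 := add_lt_add_of_le_of_lt h1 ht'
    _ = ε := add_halves ε

end WeakContinuity

/-! ### Real-valued integrals against the kernels -/

section Bochner

variable {d : ℕ} {V : Set (Vel d)} {p : V → V → ℝ} {γ : ℝ} {σ : C(Torus d, ℝ)}

theorem jump_eq (σ : C(Torus d, ℝ)) (p : V → V → ℝ) (z : Phase V) :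
    jump V σ p z = ENNReal.ofReal (‖σ‖ - σ z.1) • Measure.dirac z +
      ENNReal.ofReal (σ z.1) • (scatter V p z.2).map (fun w => (z.1, w)) := by
  refine Measure.ext_of_lintegral _ fun f hf => ?_
  have hm : Measurable fun w : V => (z.1, w) := by fun_prop
  rw [lintegral_jump σ p z hf, lintegral_add_measure, lintegral_smul_measure,
    lintegral_smul_measure, lintegral_dirac' _ hf, lintegral_map hf hm, smul_eq_mul, smul_eq_mul]

theorem jumpAlong_eq (σ : C(Torus d, ℝ)) (p : V → V → ℝ) (s : ℝ) (z : Phase V) :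
    jumpAlong V σ p (s, z) = (jump V σ p (flow V s z)).map (flow V (-s)) := by
  refine Measure.ext_of_lintegral _ fun f hf => ?_
  rw [lintegral_jumpAlong σ p s z hf, lintegral_map hf (measurable_flow_right V _)]

theorem pulled_eq (M a : ℝ) (μ : Kernel ℝ (Phase V)) [IsSFiniteKernel μ] (s : ℝ) :
    pulled M a μ s = ENNReal.ofReal (Real.exp (M * s)) • (μ (a + s)).map (flow V (-s)) := by
  refine Measure.ext_of_lintegral _ fun f hf => ?_
  rw [lintegral_pulled _ _ _ _ hf, lintegral_smul_measure, smul_eq_mul,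
    lintegral_map hf (measurable_flow_right V _)]

theorem IsScattering.integral_scatter (h : IsScattering V p γ) (v : V) (f : V → ℝ) :
    ∫ w, f w ∂(scatter V p v) = ∫ w, p w v * f w ∂(leb V) := by
  have hp' : Measurable (Function.uncurry fun (v' v : V) => ENNReal.ofReal (p v v')) :=
    (h.measurable.comp measurable_swap).ennreal_ofReal
  have hpv : Measurable fun w : V => ENNReal.ofReal (p w v) :=
    (h.measurable.comp (by fun_prop : Measurable fun w : V => (w, v))).ennreal_ofReal
  unfold scatter
  rw [Kernel.withDensity_apply _ hp', Kernel.const_apply,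
    integral_withDensity_eq_integral_toReal_smul hpv
      (Filter.Eventually.of_forall fun _ => ENNReal.ofReal_lt_top)]
  simp only [ENNReal.toReal_ofReal (h.nonneg _ v), smul_eq_mul]

theorem IsScattering.integral_jump (h : IsScattering V p γ) (hσ : ∀ x, 0 ≤ σ x) (z : Phase V)
    {f : Phase V → ℝ} (hf : Measurable f) {C : ℝ} (hC : ∀ z, ‖f z‖ ≤ C) :
    ∫ y, f y ∂(jump V σ p z) = (‖σ‖ - σ z.1) * f z +
      σ z.1 * ∫ w, p w z.2 * f (z.1, w) ∂(leb V) := by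
  have := h.isMarkovKernel_scatter
  have hm : Measurable fun w : V => (z.1, w) := by fun_prop
  have hi : ∀ (m : Measure (Phase V)) [IsFiniteMeasure m], Integrable f m := fun m _ =>
    Integrable.of_bound hf.aestronglyMeasurable C (Filter.Eventually.of_forall hC)
  rw [jump_eq, integral_add_measure ((hi _).smul_measure ENNReal.ofReal_ne_top)
    ((hi _).smul_measure ENNReal.ofReal_ne_top), integral_smul_measure, integral_smul_measure,
    integral_dirac' _ _ hf.stronglyMeasurable, integral_map hm.aemeasurable
      hf.aestronglyMeasurable, h.integral_scatter, ENNReal.toReal_ofReal (sub_rate_nonneg σ _),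
    ENNReal.toReal_ofReal (hσ _), smul_eq_mul, smul_eq_mul]

end Bochner

/-! ### Test functions carried by the flow -/

section Tests

variable {d : ℕ} {V : Set (Vel d)} {p : V → V → ℝ} {γ : ℝ} {σ : C(Torus d, ℝ)}

/-- Lets continuity on the torus be read off the periodic lift, the only form in which smoothness of
test functions is given. -/
theorem isOpenQuotientMap_toTorus : IsOpenQuotientMap (toTorus : Vel d → Torus d) := by
  have h : IsOpenQuotientMap (fun (y : Fin d → ℝ) (i : Fin d) => ((y i : ℝ) : UnitAddCircle)) :=
    IsOpenQuotientMap.piMap fun _ => QuotientAddGroup.isOpenQuotientMap_mk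
  exact h.comp (PiLp.homeomorph 2 (fun _ : Fin d => ℝ)).isOpenQuotientMap

theorem IsPhaseTest.continuous {ψ : Torus d → Vel d → ℝ} (hψ : IsPhaseTest V ψ) :
    Continuous fun z : Torus d × Vel d => ψ z.1 z.2 := by
  have hq := (isOpenQuotientMap_toTorus (d := d)).prodMap
    (IsOpenQuotientMap.id (X := Vel d))
  exact hq.isQuotientMap.continuous_iff.2 hψ.contDiff.continuous

theorem IsPhaseTest.exists_bound {ψ : Torus d → Vel d → ℝ} (hψ : IsPhaseTest V ψ) :
    ∃ C, ∀ x v, ‖ψ x v‖ ≤ C := by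
  obtain ⟨K, -, hK, h0⟩ := hψ.support
  obtain ⟨C, hC⟩ := ((isCompact_univ (X := Torus d)).prod hK).exists_bound_of_continuousOn
    hψ.continuous.continuousOn
  refine ⟨max C 0, fun x v => ?_⟩
  by_cases hv : v ∈ K
  · exact (hC (x, v) ⟨mem_univ _, hv⟩).trans (le_max_left _ _)
  · rw [h0 x v hv, norm_zero]; exact le_max_right _ _

/-- The test function transported along the free flow. -/
def travel (χ : ℝ → ℝ) (M : ℝ) (ψ : Torus d → Vel d → ℝ) (t : ℝ) (x : Torus d) (v : Vel d) : ℝ :=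
  χ t * (Real.exp (M * t) * ψ (x + toTorus ((-t) • v)) v)

/-- The flow leaves velocities unchanged, so the support stays over the same compact subset of V for
all times. -/
theorem IsPhaseTest.isTest_travel {ψ : Torus d → Vel d → ℝ} (hψ : IsPhaseTest V ψ) {χ : ℝ → ℝ}
    (hχ : ContDiff ℝ 1 χ) (hχc : HasCompactSupport χ) {τ : ℝ} (hχs : tsupport χ ⊆ Iio τ) (M : ℝ) :
    IsTest V τ (travel χ M ψ) := by
  obtain ⟨K, hKV, hK, h0⟩ := hψ.support
  have hz : ∀ z : ℝ × Torus d × Vel d, z ∉ tsupport χ ×ˢ (univ ×ˢ K) →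
      travel χ M ψ z.1 z.2.1 z.2.2 = 0 := by
    intro z hz
    simp only [mem_prod, mem_univ, true_and, not_and_or] at hz
    rcases hz with hz | hz
    · rw [travel, image_eq_zero_of_notMem_tsupport hz, zero_mul]
    · rw [travel, h0 _ _ hz, mul_zero, mul_zero]
  have hcomp : IsCompact (tsupport χ ×ˢ ((univ : Set (Torus d)) ×ˢ K)) :=
    IsCompact.prod hχc (isCompact_univ.prod hK)
  refine ⟨?_, HasCompactSupport.intro hcomp hz, ?_⟩
  · have h1 : ContDiff ℝ 1 fun z : ℝ × Vel d × Vel d =>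
        ψ (toTorus (z.2.1 + (-z.1) • z.2.2)) z.2.2 := by
      have h2 : ContDiff ℝ 1 fun z : ℝ × Vel d × Vel d => (z.2.1 + (-z.1) • z.2.2, z.2.2) := by
        fun_prop
      exact hψ.contDiff.comp h2
    simp only [toTorus_add] at h1
    have h3 : ContDiff ℝ 1 fun z : ℝ × Vel d × Vel d => χ z.1 := hχ.comp contDiff_fst
    have h4 : ContDiff ℝ 1 fun z : ℝ × Vel d × Vel d => Real.exp (M * z.1) := by fun_prop
    exact h3.mul (h4.mul h1)
  · have hsub : tsupport (fun z : ℝ × Torus d × Vel d => travel χ M ψ z.1 z.2.1 z.2.2)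
        ⊆ tsupport χ ×ˢ (univ ×ˢ K) := by
      refine closure_minimal (fun z hz' => ?_) hcomp.isClosed
      by_contra h
      exact hz' (hz z h)
    intro z hz'
    have := hsub hz'
    exact ⟨hχs this.1, hKV this.2.2⟩

/-- The function ψ(x - tv, v) is constant along trajectories, so its time derivative cancels the
transport term. The factor ‖σ‖ from differentiating the exponential joins σ(L - 1) to form the jump
kernel. -/
theorem IsScattering.dualOp_travel (h : IsScattering V p γ) (hσ : ∀ x, 0 ≤ σ x)
    {ψ : Torus d → Vel d → ℝ} (hψ : IsPhaseTest V ψ) {χ : ℝ → ℝ} (hχ : ContDiff ℝ 1 χ) (t : ℝ)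
    (z : Phase V) :
    dualOp V σ p (travel χ ‖σ‖ ψ) t z
      = deriv χ t * (Real.exp (‖σ‖ * t) * ψ (flow V (-t) z).1 (flow V (-t) z).2) +
        χ t * (Real.exp (‖σ‖ * t) *
          ∫ y, ψ (flow V (-t) y).1 (flow V (-t) y).2 ∂(jump V σ p z)) := by
  obtain ⟨x, v⟩ := z
  set k : ℝ → ℝ := fun s => ψ (x + toTorus ((-s) • (v : Vel d))) v with hk
  have hkd : Differentiable ℝ k := by
    obtain ⟨y, rfl⟩ := toTorus_surjective x
    have h1 : ContDiff ℝ 1 fun s : ℝ => ψ (toTorus (y + (-s) • (v : Vel d))) v := by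
      have h2 : ContDiff ℝ 1 fun s : ℝ => (y + (-s) • (v : Vel d), (v : Vel d)) := by fun_prop
      exact hψ.contDiff.comp h2
    simp only [toTorus_add] at h1
    exact h1.differentiable one_ne_zero
  have d1 : deriv (fun s => travel χ ‖σ‖ ψ s x v) t
      = deriv χ t * (Real.exp (‖σ‖ * t) * k t) +
        χ t * (‖σ‖ * Real.exp (‖σ‖ * t) * k t + Real.exp (‖σ‖ * t) * deriv k t) := by
    have he : HasDerivAt (fun s => Real.exp (‖σ‖ * s)) (‖σ‖ * Real.exp (‖σ‖ * t)) t := by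
      have := ((hasDerivAt_id t).const_mul ‖σ‖).exp
      refine this.congr_deriv ?_
      simp [mul_comm]
    exact (((hχ.differentiable one_ne_zero) t).hasDerivAt.mul (he.mul (hkd t).hasDerivAt)).deriv
  have d2 : deriv (fun s : ℝ => travel χ ‖σ‖ ψ t (x + toTorus (s • (v : Vel d))) v) 0
      = -(χ t * (Real.exp (‖σ‖ * t) * deriv k t)) := by
    have e : (fun s : ℝ => travel χ ‖σ‖ ψ t (x + toTorus (s • (v : Vel d))) v)
        = fun s => χ t * (Real.exp (‖σ‖ * t) * k (t - s)) := by
      funext s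
      rw [travel, hk]
      simp only
      rw [add_assoc, ← toTorus_add, ← add_smul]
      congr 6
      ring
    have h1 : HasDerivAt (fun s => k (t - s)) (-deriv k t) 0 := by
      have h2 : HasDerivAt k (deriv k t) (t - 0) := by rw [sub_zero]; exact (hkd t).hasDerivAt
      exact HasDerivAt.comp_const_sub t 0 h2
    rw [e, ((h1.const_mul _).const_mul _).deriv]
    ring
  have hm : Measurable fun y : Phase V => ψ (flow V (-t) y).1 (flow V (-t) y).2 := by
    have h1 : Continuous fun y : Phase V => ((flow V (-t) y).1, ((flow V (-t) y).2 : Vel d)) := by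
      have h2 : Continuous (flow V (-t)) :=
        (continuous_flow V).comp (by fun_prop : Continuous fun z : Phase V => (-t, z))
      exact (continuous_fst.comp h2).prodMk (continuous_subtype_val.comp (continuous_snd.comp h2))
    exact (hψ.continuous.comp h1).measurable
  obtain ⟨C, hC⟩ := hψ.exists_bound
  rw [h.integral_jump hσ (x, v) hm (fun z => hC _ _)]
  unfold dualOp
  simp only
  rw [d1, d2]
  have e3 : ∫ w : V, p w v * travel χ ‖σ‖ ψ t x w ∂(leb V)
      = χ t * (Real.exp (‖σ‖ * t) *
        ∫ w : V, p w v * ψ (flow V (-t) (x, w)).1 (flow V (-t) (x, w)).2 ∂(leb V)) := by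
    rw [← integral_const_mul, ← integral_const_mul]
    refine integral_congr_ae (Filter.Eventually.of_forall fun w => ?_)
    simp only [travel, flow]
    ring
  rw [e3]
  have e4 : travel χ ‖σ‖ ψ t x v = χ t * (Real.exp (‖σ‖ * t) * k t) := rfl
  have e5 : ψ (flow V (-t) (x, v)).1 (flow V (-t) (x, v)).2 = k t := rfl
  rw [e4, e5]
  ring

end Tests

/-! ### From measure solutions to the integral equation -/

section Mild

variable {d : ℕ} {V : Set (Vel d)} {p : V → V → ℝ} {γ : ℝ} {σ : C(Torus d, ℝ)}

/-- Nothing is assumed at negative times. Freezing the curve there at its value at 0 gives a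
continuous curve on ℝ, hence a kernel. -/
theorem IsMeasureSolution.continuous {μ₀ : ProbabilityMeasure (Phase V)}
    {μ : ℝ → ProbabilityMeasure (Phase V)} (h : IsMeasureSolution V σ p μ₀ μ) :
    Continuous fun t => μ (max t 0) := by
  have hc : ContinuousOn μ (Ici 0) := by
    intro t ht
    have ht0 : (0 : ℝ) ≤ t := ht
    have h1 := (h (t + 1) (by linarith)).1 t ⟨ht0, by linarith⟩
    refine h1.mono_of_mem_nhdsWithin ?_
    have h2 : Ici (0 : ℝ) ∩ Iio (t + 1) ∈ nhdsWithin t (Ici 0) :=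
      Filter.inter_mem self_mem_nhdsWithin
        (mem_nhdsWithin_of_mem_nhds (Iio_mem_nhds (by linarith)))
    exact Filter.mem_of_superset h2 fun s hs => ⟨hs.1, (show s < t + 1 from hs.2).le⟩
  exact hc.comp_continuous (by fun_prop) fun t => le_max_right t 0

/-- The solution curve, as a kernel. -/
def IsMeasureSolution.kernel {μ₀ : ProbabilityMeasure (Phase V)}
    {μ : ℝ → ProbabilityMeasure (Phase V)} (h : IsMeasureSolution V σ p μ₀ μ) :
    Kernel ℝ (Phase V) where
  toFun t := μ (max t 0)
  measurable' := measurable_coe_of_continuous h.continuous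

theorem IsMeasureSolution.kernel_apply {μ₀ : ProbabilityMeasure (Phase V)}
    {μ : ℝ → ProbabilityMeasure (Phase V)} (h : IsMeasureSolution V σ p μ₀ μ) (t : ℝ) :
    h.kernel t = (μ (max t 0) : Measure (Phase V)) := rfl

instance {μ₀ : ProbabilityMeasure (Phase V)}
    {μ : ℝ → ProbabilityMeasure (Phase V)} (h : IsMeasureSolution V σ p μ₀ μ) :
    IsMarkovKernel h.kernel :=
  ⟨fun t => by rw [h.kernel_apply]; infer_instance⟩

/-- `s ↦ ∫ 𝒩_s(z, ·) ρ_s(dz)`. -/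
def gain (κ : Kernel (ℝ × Phase V) (Phase V)) (ρ : Kernel ℝ (Phase V)) : Kernel ℝ (Phase V) :=
  κ ∘ₖ (Kernel.id ×ₖ ρ)

instance (κ : Kernel (ℝ × Phase V) (Phase V)) [IsSFiniteKernel κ] (ρ : Kernel ℝ (Phase V))
    [IsSFiniteKernel ρ] : IsSFiniteKernel (gain κ ρ) := by
  unfold gain; infer_instance

theorem id_prod_apply (ρ : Kernel ℝ (Phase V)) [IsSFiniteKernel ρ] (s : ℝ) :
    (Kernel.id ×ₖ ρ) s = (ρ s).map (fun z => (s, z)) := by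
  rw [Kernel.prod_apply, Kernel.id_apply, Measure.dirac_prod]

theorem lintegral_gain (κ : Kernel (ℝ × Phase V) (Phase V)) [IsSFiniteKernel κ]
    (ρ : Kernel ℝ (Phase V)) [IsSFiniteKernel ρ] (s : ℝ) {f : Phase V → ℝ≥0∞} (hf : Measurable f) :
    ∫⁻ y, f y ∂(gain κ ρ s) = ∫⁻ z, ∫⁻ y, f y ∂(κ (s, z)) ∂(ρ s) := by
  have hm : Measurable fun z : Phase V => (s, z) := by fun_prop
  rw [gain, Kernel.lintegral_comp _ _ _ hf, id_prod_apply, lintegral_map hf.lintegral_kernel hm]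

theorem integral_gain (κ : Kernel (ℝ × Phase V) (Phase V)) [IsSFiniteKernel κ]
    (ρ : Kernel ℝ (Phase V)) [IsSFiniteKernel ρ] (s : ℝ) {f : Phase V → ℝ} (hf : Measurable f)
    (hi : Integrable f (gain κ ρ s)) :
    ∫ y, f y ∂(gain κ ρ s) = ∫ z, ∫ y, f y ∂(κ (s, z)) ∂(ρ s) := by
  have hm : Measurable fun z : Phase V => (s, z) := by fun_prop
  have hk : StronglyMeasurable fun q => ∫ y, f y ∂(κ q) := hf.stronglyMeasurable.integral_kernel
  unfold gain at hi ⊢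
  rw [Kernel.integral_comp hi, id_prod_apply, integral_map hm.aemeasurable hk.aestronglyMeasurable]

theorem IsMeasureSolution.pulled_univ {μ₀ : ProbabilityMeasure (Phase V)}
    {μ : ℝ → ProbabilityMeasure (Phase V)} (h : IsMeasureSolution V σ p μ₀ μ) (s : ℝ) :
    pulled ‖σ‖ 0 h.kernel s univ = ENNReal.ofReal (Real.exp (‖σ‖ * s)) := by
  rw [← lintegral_one, lintegral_pulled _ _ _ _ measurable_const]
  simp

instance {μ₀ : ProbabilityMeasure (Phase V)} {μ : ℝ → ProbabilityMeasure (Phase V)}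
    (h : IsMeasureSolution V σ p μ₀ μ) (s : ℝ) : IsFiniteMeasure (pulled ‖σ‖ 0 h.kernel s) :=
  ⟨by rw [h.pulled_univ]; exact ENNReal.ofReal_lt_top⟩

theorem IsMeasureSolution.gain_univ (hs : IsScattering V p γ) (hσ : ∀ x, 0 ≤ σ x)
    {μ₀ : ProbabilityMeasure (Phase V)} {μ : ℝ → ProbabilityMeasure (Phase V)}
    (h : IsMeasureSolution V σ p μ₀ μ) (s : ℝ) :
    gain (jumpAlong V σ p) (pulled ‖σ‖ 0 h.kernel) s univ
      = ENNReal.ofReal (‖σ‖ * Real.exp (‖σ‖ * s)) := by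
  rw [← lintegral_one, lintegral_gain _ _ _ measurable_const]
  simp only [lintegral_one, hs.jumpAlong_univ hσ, lintegral_const, h.pulled_univ]
  rw [ENNReal.ofReal_mul (norm_nonneg _)]

theorem IsMeasureSolution.isFiniteMeasure_gain (hs : IsScattering V p γ) (hσ : ∀ x, 0 ≤ σ x)
    {μ₀ : ProbabilityMeasure (Phase V)} {μ : ℝ → ProbabilityMeasure (Phase V)}
    (h : IsMeasureSolution V σ p μ₀ μ) (s : ℝ) :
    IsFiniteMeasure (gain (jumpAlong V σ p) (pulled ‖σ‖ 0 h.kernel) s) :=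
  ⟨by rw [h.gain_univ hs hσ]; exact ENNReal.ofReal_lt_top⟩

theorem IsMeasureSolution.isFiniteMeasure_compProd_gain (hs : IsScattering V p γ)
    (hσ : ∀ x, 0 ≤ σ x) {μ₀ : ProbabilityMeasure (Phase V)} {μ : ℝ → ProbabilityMeasure (Phase V)}
    (h : IsMeasureSolution V σ p μ₀ μ) {t : ℝ} (ht : 0 ≤ t) :
    IsFiniteMeasure
      ((volume.restrict (Ioc 0 t)) ⊗ₘ (gain (jumpAlong V σ p) (pulled ‖σ‖ 0 h.kernel))) := by
  constructor
  rw [← lintegral_one, Measure.lintegral_compProd measurable_const]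
  simp only [lintegral_one, h.gain_univ hs hσ]
  exact (le_add_self.trans_eq (lintegral_exp_mul (norm_nonneg σ) ht)).trans_lt
    ENNReal.ofReal_lt_top

/-- The integral equation, against test functions. -/
theorem IsMeasureSolution.integral_pulled_eq (hs : IsScattering V p γ) (hσ : ∀ x, 0 ≤ σ x)
    {μ₀ : ProbabilityMeasure (Phase V)} {μ : ℝ → ProbabilityMeasure (Phase V)}
    (h : IsMeasureSolution V σ p μ₀ μ) {ψ : Torus d → Vel d → ℝ} (hψ : IsPhaseTest V ψ)
    {t : ℝ} (ht : 0 ≤ t) :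
    ∫ z, ψ z.1 z.2 ∂(pulled ‖σ‖ 0 h.kernel t) = ∫ z, ψ z.1 z.2 ∂(μ₀ : Measure (Phase V)) +
      ∫ s in (0 : ℝ)..t, ∫ z, ψ z.1 z.2 ∂(gain (jumpAlong V σ p) (pulled ‖σ‖ 0 h.kernel) s) := by
  set κ := jumpAlong V σ p with hκdef
  set ρ := pulled ‖σ‖ 0 h.kernel with hρdef
  have hηf : ∀ s, IsFiniteMeasure (gain κ ρ s) := h.isFiniteMeasure_gain hs hσ
  have hcf : ∀ t, 0 ≤ t → IsFiniteMeasure ((volume.restrict (Ioc 0 t)) ⊗ₘ (gain κ ρ)) :=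
    fun t ht => h.isFiniteMeasure_compProd_gain hs hσ ht
  obtain ⟨C, hC⟩ := hψ.exists_bound
  have hψc : Continuous fun z : Phase V => ψ z.1 z.2 :=
    hψ.continuous.comp (by fun_prop : Continuous fun z : Phase V => (z.1, (z.2 : Vel d)))
  have hψm := hψc.measurable
  have hψi : ∀ (m : Measure (Phase V)) [IsFiniteMeasure m],
      Integrable (fun z : Phase V => ψ z.1 z.2) m := fun m _ =>
    Integrable.of_bound hψm.aestronglyMeasurable C (Filter.Eventually.of_forall fun z => hC _ _)
  have hflow : ∀ t, Continuous (flow V t) := fun t =>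
    (continuous_flow V).comp (by fun_prop : Continuous fun z : Phase V => (t, z))
  set g : ℝ → Phase V → ℝ := fun t z => ψ (flow V (-t) z).1 (flow V (-t) z).2 with hg
  set N : ℝ → Phase V → ℝ := fun t z => ∫ y, g t y ∂(jump V σ p z) with hN
  have hgc : ∀ t, Continuous (g t) := fun t => hψc.comp (hflow (-t))
  have hG : ∀ t, 0 ≤ t → ∫ z, ψ z.1 z.2 ∂(ρ t)
      = Real.exp (‖σ‖ * t) * ∫ z, g t z ∂(μ t : Measure (Phase V)) := by
    intro t ht
    rw [hρdef, pulled_eq, integral_smul_measure, integral_map (hflow _).measurable.aemeasurable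
      hψm.aestronglyMeasurable, ENNReal.toReal_ofReal (Real.exp_pos _).le, smul_eq_mul,
      h.kernel_apply, zero_add, max_eq_left ht]
  have hκN : ∀ t z, ∫ y, ψ y.1 y.2 ∂(κ (t, flow V (-t) z)) = N t z := by
    intro t z
    rw [hκdef, jumpAlong_eq, integral_map (hflow _).measurable.aemeasurable
      hψm.aestronglyMeasurable, flow_flow, add_neg_cancel, flow_zero]
  have hH : ∀ t, 0 ≤ t → ∫ z, ψ z.1 z.2 ∂(gain κ ρ t)
      = Real.exp (‖σ‖ * t) * ∫ z, N t z ∂(μ t : Measure (Phase V)) := by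
    intro t ht
    have hk : StronglyMeasurable fun z => ∫ y, ψ y.1 y.2 ∂(κ (t, z)) :=
      (hψm.stronglyMeasurable.integral_kernel (κ := κ)).comp_measurable
        (by fun_prop : Measurable fun z : Phase V => (t, z))
    rw [integral_gain κ ρ t hψm (hψi _), hρdef, pulled_eq, integral_smul_measure,
      integral_map (hflow _).measurable.aemeasurable hk.aestronglyMeasurable,
      ENNReal.toReal_ofReal (Real.exp_pos _).le, smul_eq_mul,
      h.kernel_apply, zero_add, max_eq_left ht]
    simp only [hκN]
  have hHi : ∀ τ, 0 ≤ τ →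
      IntervalIntegrable (fun t => ∫ z, ψ z.1 z.2 ∂(gain κ ρ t)) volume 0 τ := by
    intro τ hτ
    have := hcf τ hτ
    rw [intervalIntegrable_iff_integrableOn_Ioc_of_le hτ]
    have hi : Integrable (fun q : ℝ × Phase V => ψ q.2.1 q.2.2)
        ((volume.restrict (Ioc 0 τ)) ⊗ₘ (gain κ ρ)) :=
      Integrable.of_bound (hψm.comp measurable_snd).aestronglyMeasurable C
        (Filter.Eventually.of_forall fun z => hC _ _)
    rw [Measure.compProd] at hi
    have := MeasureTheory.Integrable.integral_compProd hi
    simpa [IntegrableOn] using this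
  -- The integrand moves with t as well as the measure, so weak continuity alone is not enough; the
  -- compact support of ψ in velocity supplies the missing uniformity.
  have hGc : Continuous fun t => Real.exp (‖σ‖ * t) *
      ∫ z, g t z ∂(μ (max t 0) : Measure (Phase V)) := by
    obtain ⟨K, hKV, hK, h0⟩ := hψ.support
    have hK' : IsCompact ((univ : Set (Torus d)) ×ˢ (Subtype.val ⁻¹' K : Set V)) := by
      refine isCompact_univ.prod (Subtype.isCompact_iff.2 ?_)
      rwa [Subtype.image_preimage_coe, inter_eq_right.2 hKV]
    have hgj : Continuous (Function.uncurry g) :=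
      hψc.comp ((continuous_flow V).comp
        (by fun_prop : Continuous fun q : ℝ × Phase V => (-q.1, q.2)))
    have := continuous_integral_of_compact h.continuous hgj hK' (fun t z hz => h0 _ _ fun hz' =>
      hz ⟨mem_univ _, hz'⟩)
    fun_prop
  have key : ∀ τ, 0 < τ → ∀ t ∈ Icc 0 τ, ∫ z, ψ z.1 z.2 ∂(ρ t)
      = ∫ z, ψ z.1 z.2 ∂(μ₀ : Measure (Phase V)) +
        ∫ s in (0 : ℝ)..t, ∫ z, ψ z.1 z.2 ∂(gain κ ρ s) := by
    intro τ hτ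
    refine eq_add_integral_of_weak hτ ?_ (hHi τ hτ.le) fun χ hχ hχc hχs => ?_
    · refine hGc.continuousOn.congr fun t ht => ?_
      simp only [hG t ht.1, max_eq_left ht.1]
    · have hw := (h τ hτ).2 _ (hψ.isTest_travel hχ hχc hχs ‖σ‖)
      have e0 : ∫ z : Phase V, travel χ ‖σ‖ ψ 0 z.1 z.2 ∂(μ₀ : Measure (Phase V))
          = χ 0 * ∫ z, ψ z.1 z.2 ∂(μ₀ : Measure (Phase V)) := by
        rw [← integral_const_mul]
        simp only [travel, mul_zero, Real.exp_zero, one_mul, neg_zero, zero_smul, toTorus_zero,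
          add_zero]
      rw [e0] at hw
      rw [← hw]
      refine intervalIntegral.integral_congr fun t ht => ?_
      rw [uIcc_of_le hτ.le] at ht
      have hNi : Integrable (N t) (μ t : Measure (Phase V)) := by
        refine Integrable.of_bound
          ((hgc t).measurable.stronglyMeasurable.integral_kernel.aestronglyMeasurable)
          (C * ‖σ‖) (Filter.Eventually.of_forall fun z => ?_)
        have hfin : IsFiniteMeasure (jump V σ p z) :=
          ⟨by rw [hs.jump_univ hσ]; exact ENNReal.ofReal_lt_top⟩
        have := norm_integral_le_of_norm_le_const (μ := jump V σ p z) (f := g t) (C := C)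
          (Filter.Eventually.of_forall fun y => hC _ _)
        rwa [measureReal_def, hs.jump_univ hσ, ENNReal.toReal_ofReal (norm_nonneg _)] at this
      have hgi : Integrable (g t) (μ t : Measure (Phase V)) :=
        Integrable.of_bound (hgc t).measurable.aestronglyMeasurable C
          (Filter.Eventually.of_forall fun z => hC _ _)
      simp only [hs.dualOp_travel hσ hψ hχ]
      rw [hG t ht.1, hH t ht.1, integral_add ((hgi.const_mul _).const_mul _)
        ((hNi.const_mul _).const_mul _)]
      simp only [integral_const_mul]
  -- A horizon beyond t is used because the weak formulation needs τ > 0, while t = 0 must be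
  -- covered.
  exact key (t + 1) (by linarith) t ⟨ht, by linarith⟩

/-- The weak formulation mentions μ₀ only on its right-hand side; that the curve starts there
follows from the integral identity at t = 0. -/
theorem IsMeasureSolution.pulled_zero (hs : IsScattering V p γ) (hσ : ∀ x, 0 ≤ σ x)
    {μ₀ : ProbabilityMeasure (Phase V)} {μ : ℝ → ProbabilityMeasure (Phase V)}
    (h : IsMeasureSolution V σ p μ₀ μ) :
    pulled ‖σ‖ 0 h.kernel 0 = (μ₀ : Measure (Phase V)) :=
  ext_of_isPhaseTest hs.isOpen hs.isBounded fun ψ hψ => by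
    rw [h.integral_pulled_eq hs hσ hψ le_rfl, intervalIntegral.integral_same, add_zero]

/-- A measure solution takes its initial value. -/
theorem IsMeasureSolution.apply_zero (hs : IsScattering V p γ) (hσ : ∀ x, 0 ≤ σ x)
    {μ₀ : ProbabilityMeasure (Phase V)} {μ : ℝ → ProbabilityMeasure (Phase V)}
    (h : IsMeasureSolution V σ p μ₀ μ) : (μ 0 : Measure (Phase V)) = μ₀ := by
  rw [← h.pulled_zero hs hσ, pulled_eq, mul_zero, Real.exp_zero, ENNReal.ofReal_one, one_smul,
    h.kernel_apply, add_zero, max_self, neg_zero, funext (flow_zero (V := V)), Measure.map_id']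

/-- The identity against test functions says that two finite measures agree, the second one being
the initial measure plus the time-integrated gain. Once it is an equality of measures, every
nonnegative measurable f may be inserted. -/
theorem IsMeasureSolution.isMild (hs : IsScattering V p γ) (hσ : ∀ x, 0 ≤ σ x)
    {μ₀ : ProbabilityMeasure (Phase V)} {μ : ℝ → ProbabilityMeasure (Phase V)}
    (h : IsMeasureSolution V σ p μ₀ μ) : IsMild σ p 0 h.kernel := by
  intro t _ s hst f hf
  have := h.isFiniteMeasure_compProd_gain hs hσ hst.1
  have hm : pulled ‖σ‖ 0 h.kernel s = pulled ‖σ‖ 0 h.kernel 0 + ((volume.restrict (Ioc 0 s)) ⊗ₘ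
      (gain (jumpAlong V σ p) (pulled ‖σ‖ 0 h.kernel))).map Prod.snd := by
    refine ext_of_isPhaseTest hs.isOpen hs.isBounded fun ψ hψ => ?_
    obtain ⟨C, hC⟩ := hψ.exists_bound
    have hψm : Measurable fun z : Phase V => ψ z.1 z.2 := (hψ.continuous.comp
      (by fun_prop : Continuous fun z : Phase V => (z.1, (z.2 : Vel d)))).measurable
    have hψi : ∀ (m : Measure (Phase V)) [IsFiniteMeasure m],
        Integrable (fun z : Phase V => ψ z.1 z.2) m := fun m _ =>
      Integrable.of_bound hψm.aestronglyMeasurable C (Filter.Eventually.of_forall fun z => hC _ _)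
    rw [h.integral_pulled_eq hs hσ hψ hst.1, h.pulled_zero hs hσ, integral_add_measure (hψi _) (hψi _),
      integral_map measurable_snd.aemeasurable hψm.aestronglyMeasurable,
      Measure.integral_compProd, intervalIntegral.integral_of_le hst.1]
    exact Integrable.of_bound (hψm.comp measurable_snd).aestronglyMeasurable C
      (Filter.Eventually.of_forall fun z => hC _ _)
  conv_lhs => rw [hm]
  have hf2 : Measurable fun q : ℝ × Phase V => f q.2 := hf.comp measurable_snd
  rw [lintegral_add_measure, lintegral_map hf measurable_snd, Measure.lintegral_compProd hf2]
  simp only [lintegral_gain (jumpAlong V σ p) (pulled ‖σ‖ 0 h.kernel) _ hf]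

end Mild

/-! ### Spreading of mass by free transport -/

section Spreading

/-- An interval of integer length is a union of n fundamental domains, each mapped onto Lebesgue
measure of the circle. -/
theorem map_coe_restrict_Ioc_natCast (b : ℝ) (n : ℕ) :
    ((volume.restrict (Ioc b (b + n))).map ((↑) : ℝ → UnitAddCircle))
      = (n : ℝ≥0∞) • (volume : Measure UnitAddCircle) := by
  have hm : Measurable ((↑) : ℝ → UnitAddCircle) := (AddCircle.continuous_mk' (1 : ℝ)).measurable
  induction n with
  | zero => simp
  | succ n ih =>
    have hun : Ioc b (b + (n + 1 : ℕ)) = Ioc b (b + n) ∪ Ioc (b + n) (b + n + 1) := by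
      rw [Ioc_union_Ioc_eq_Ioc (by simp) (by simp)]
      push_cast
      rw [add_assoc]
    rw [hun, Measure.restrict_union (Ioc_disjoint_Ioc_of_le le_rfl) measurableSet_Ioc,
      Measure.map_add _ _ hm, ih, (UnitAddCircle.measurePreserving_mk (b + n)).map_eq]
    push_cast
    rw [add_smul, one_smul]

/-- Free transport spreads an interval of velocities uniformly over the circle. -/
theorem map_transport_Ioc {t : ℝ} (ht : 0 < t) (a : ℝ) (n : ℕ) (x : UnitAddCircle) :
    (volume.restrict (Ioc a (a + n / t))).map (fun u : ℝ => x + ((t * u : ℝ) : UnitAddCircle))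
      = ENNReal.ofReal (n / t) • (volume : Measure UnitAddCircle) := by
  have hm : Measurable ((↑) : ℝ → UnitAddCircle) := (AddCircle.continuous_mk' (1 : ℝ)).measurable
  have ht' : Measurable fun u : ℝ => t * u := by fun_prop
  have hx : Measurable fun y : UnitAddCircle => x + y := by fun_prop
  have hpre : Ioc a (a + n / t) = (fun u => t * u) ⁻¹' Ioc (t * a) (t * a + n) := by
    ext u
    have e : t * (a + n / t) = t * a + n := by field_simp
    simp only [mem_Ioc, mem_preimage, ← e]
    rw [mul_lt_mul_iff_right₀ ht, mul_le_mul_iff_right₀ ht]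
  have h1 : (volume.restrict (Ioc a (a + n / t))).map (fun u => t * u)
      = ENNReal.ofReal t⁻¹ • volume.restrict (Ioc (t * a) (t * a + n)) := by
    rw [hpre, ← Measure.restrict_map ht' measurableSet_Ioc, Real.map_volume_mul_left ht.ne',
      Measure.restrict_smul, abs_of_pos (inv_pos.2 ht)]
  have h2 : (fun u : ℝ => x + ((t * u : ℝ) : UnitAddCircle))
      = (fun y : UnitAddCircle => x + y) ∘ ((↑) : ℝ → UnitAddCircle) ∘ fun u => t * u := rfl
  rw [h2, ← Measure.map_map hx (hm.comp ht'), ← Measure.map_map hm ht', h1, Measure.map_smul,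
    map_coe_restrict_Ioc_natCast, Measure.map_smul, Measure.map_smul,
    (measurePreserving_add_left volume x).map_eq, smul_smul]
  congr 1
  rw [div_eq_inv_mul, ENNReal.ofReal_mul (inv_pos.2 ht).le, ENNReal.ofReal_natCast]

variable {d : ℕ} {V : Set (Vel d)}

/-- An open set contains a cube. -/
theorem exists_cube_subset (hV : IsOpen V) (hne : V.Nonempty) :
    ∃ (a : Fin d → ℝ) (r : ℝ), 0 < r ∧ ∀ w : Vel d, (∀ i, w i ∈ Ioc (a i) (a i + r)) → w ∈ V := by
  obtain ⟨v, hv⟩ := hne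
  have hc : Continuous fun y : Fin d → ℝ => (WithLp.toLp 2 y : Vel d) :=
    PiLp.continuous_toLp 2 _
  have hU : IsOpen ((fun y : Fin d → ℝ => (WithLp.toLp 2 y : Vel d)) ⁻¹' V) := hV.preimage hc
  obtain ⟨ε, hε, hb⟩ := Metric.isOpen_iff.1 hU (fun i => v i) hv
  refine ⟨fun i => v i, ε / 2, half_pos hε, fun w hw => ?_⟩
  refine hb (a := fun i => w i) ?_
  rw [Metric.mem_ball]
  refine ((dist_pi_le_iff (half_pos hε).le).2 fun i => ?_).trans_lt (half_lt_self hε)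
  rw [Real.dist_eq, abs_of_pos (sub_pos.2 (hw i).1)]
  linarith [(hw i).2]

theorem marginal_transport_apply (hV : IsOpen V) [SFinite (nuV V)] (t : ℝ) (x : Torus d)
    {A : Set (Torus d)} (hA : MeasurableSet A) :
    ((transport V t ((Measure.dirac x).prod (nuV V))).map Prod.fst) A
      = (volume V)⁻¹ * volume (V ∩ {w : Vel d | x + toTorus (t • w) ∈ A}) := by
  have hm : Measurable fun w : V => (x, w) := by fun_prop
  have hflow := measurable_flow_right V t
  have hA' : MeasurableSet (Prod.fst ⁻¹' A : Set (Phase V)) := hA.preimage measurable_fst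
  rw [transport, Measure.map_apply measurable_fst hA, Measure.map_apply hflow hA',
    Measure.dirac_prod, Measure.map_apply hm (hA'.preimage hflow), nuV, Measure.smul_apply,
    smul_eq_mul, leb, comap_subtype_coe_apply hV.measurableSet]
  congr 2
  ext w
  simp [flow, and_comm]

/-- The coordinates decouple: Lebesgue measure on the cube is a product, and so is its image on the
torus, with each factor exactly uniform because t · n/t is an integer. -/
theorem le_volume_cube_inter {t : ℝ} (ht : 0 < t) (a : Fin d → ℝ) (n : ℕ) (x : Torus d)
    {A : Set (Torus d)} (hA : MeasurableSet A) :
    volume ({w : Vel d | ∀ i, w i ∈ Ioc (a i) (a i + n / t)} ∩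
        {w : Vel d | x + toTorus (t • w) ∈ A}) = ENNReal.ofReal (n / t) ^ d * nuX d A := by
  have hcoe : Measurable ((↑) : ℝ → UnitAddCircle) := (AddCircle.continuous_mk' (1 : ℝ)).measurable
  have hQ : MeasurableSet {w : Vel d | ∀ i, w i ∈ Ioc (a i) (a i + n / t)} := by
    rw [ofPred_forall]
    refine MeasurableSet.iInter fun i => ?_
    exact measurableSet_Ioc.preimage (by fun_prop : Measurable fun w : Vel d => w i)
  have hS : MeasurableSet {w : Vel d | x + toTorus (t • w) ∈ A} := by
    refine hA.preimage (f := fun w : Vel d => x + toTorus (t • w)) ?_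
    have := (continuous_toTorus (d := d)).measurable
    fun_prop
  rw [← (PiLp.volume_preserving_toLp (Fin d)).measure_preimage (hQ.inter hS).nullMeasurableSet]
  set Φ : (Fin d → ℝ) → Torus d := fun y i => x i + ((t * y i : ℝ) : UnitAddCircle) with hΦ
  have hΦm : Measurable Φ := by
    refine measurable_pi_lambda _ fun i => ?_
    exact (hcoe.comp (by fun_prop : Measurable fun y : Fin d → ℝ => t * y i)).const_add (x i)
  have hpre : (WithLp.toLp 2 : (Fin d → ℝ) → Vel d) ⁻¹'
        ({w : Vel d | ∀ i, w i ∈ Ioc (a i) (a i + n / t)} ∩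
          {w : Vel d | x + toTorus (t • w) ∈ A})
      = Φ ⁻¹' A ∩ univ.pi fun i => Ioc (a i) (a i + n / t) := by
    ext y
    simp only [mem_preimage, mem_inter_iff, mem_ofPred_eq, mem_univ_pi]
    rw [and_comm]
    rfl
  rw [hpre, ← Measure.restrict_apply (hA.preimage hΦm), volume_pi, Measure.restrict_pi_pi,
    ← Measure.map_apply hΦm hA, hΦ, Measure.pi_map_pi
      (f := fun i (u : ℝ) => x i + ((t * u : ℝ) : UnitAddCircle))
      (fun i => ((hcoe.comp (by fun_prop : Measurable fun u : ℝ => t * u)).const_add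
        (x i)).aemeasurable)]
  simp only [map_transport_Ioc ht]
  have hfin : IsFiniteMeasure (ENNReal.ofReal (n / t) • (volume : Measure UnitAddCircle)) :=
    Measure.smul_finite _ ENNReal.ofReal_ne_top
  have hpi : Measure.pi (fun _ : Fin d => ENNReal.ofReal (n / t) • (volume : Measure UnitAddCircle))
      = ENNReal.ofReal (n / t) ^ d • nuX d := by
    refine Measure.pi_eq fun s hs => ?_
    simp only [Measure.smul_apply, smul_eq_mul, Finset.prod_mul_distrib, Finset.prod_const,
      Finset.card_univ, Fintype.card_fin]
    rw [nuX, volume_pi_pi]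
  rw [hpi, Measure.smul_apply, smul_eq_mul]

/-- Free transport spreads the mass of any point over the whole torus. -/
theorem exists_spreadsMass (hV : IsOpen V) (hb : Bornology.IsBounded V) (hne : V.Nonempty) :
    ∃ Tstar β : ℝ, SpreadsMass V Tstar β := by
  have := isProbabilityMeasure_nuV hV hb hne
  obtain ⟨a, r, hr, hcube⟩ := exists_cube_subset hV hne
  have hvol : 0 < volume.real V :=
    ENNReal.toReal_pos (hV.measure_pos _ hne).ne' hb.measure_lt_top.ne
  have hβ : 0 < (r / 2) ^ d / volume.real V := by positivity
  -- From time 1/r on, a cube of side r wraps around the torus at least once. The minimum with 1/2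
  -- only ensures β < 1.
  refine ⟨1 / r, min (1 / 2) ((r / 2) ^ d / volume.real V), by positivity,
    ⟨lt_min (by norm_num) hβ, (min_le_left _ _).trans_lt (by norm_num)⟩, fun t ht x => ?_⟩
  have ht0 : 0 < t := lt_of_lt_of_le (by positivity) ht
  have htr : 1 ≤ t * r := by rwa [div_le_iff₀ hr] at ht
  -- The cube is trimmed to side n/t, so that it wraps a whole number of times. As n ≥ 1, tr < n + 1
  -- ≤ 2n, and at least half of the side survives.
  set n := ⌊t * r⌋₊ with hn
  have hn1 : (1 : ℝ) ≤ n := by exact_mod_cast (Nat.one_le_floor_iff _).2 htr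
  have hn2 : (n : ℝ) ≤ t * r := Nat.floor_le (by positivity)
  have hn3 : t * r < n + 1 := Nat.lt_floor_add_one _
  have hnt : (n : ℝ) / t ≤ r := by rw [div_le_iff₀ ht0]; linarith
  have hnt2 : r / 2 ≤ n / t := by rw [le_div_iff₀ ht0]; linarith
  refine Measure.le_iff.2 fun A hA => ?_
  rw [marginal_transport_apply hV t x hA, Measure.smul_apply, smul_eq_mul]
  have hsub : {w : Vel d | ∀ i, w i ∈ Ioc (a i) (a i + n / t)} ⊆ V := fun w hw =>
    hcube w fun i => ⟨(hw i).1, (hw i).2.trans (by linarith)⟩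
  have hV' : (volume V)⁻¹ = ENNReal.ofReal (volume.real V)⁻¹ := by
    rw [ENNReal.ofReal_inv_of_pos hvol, measureReal_def,
      ENNReal.ofReal_toReal hb.measure_lt_top.ne]
  calc ENNReal.ofReal (min (1 / 2) ((r / 2) ^ d / volume.real V)) * nuX d A
      ≤ ENNReal.ofReal ((volume.real V)⁻¹ * (n / t) ^ d) * nuX d A := by
        gcongr
        refine (min_le_right _ _).trans ?_
        rw [div_eq_inv_mul]
        gcongr
    _ = (volume V)⁻¹ * volume ({w : Vel d | ∀ i, w i ∈ Ioc (a i) (a i + n / t)} ∩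
          {w : Vel d | x + toTorus (t • w) ∈ A}) := by
        rw [le_volume_cube_inter ht0 a n x hA, ENNReal.ofReal_mul (by positivity), hV',
          ENNReal.ofReal_pow (by positivity), mul_assoc]
    _ ≤ _ := by gcongr

end Spreading

/-! ### The rate and exponential convergence -/

section Rate

variable {d : ℕ} {V : Set (Vel d)} {p : V → V → ℝ} {γ : ℝ} {σ : C(Torus d, ℝ)}

theorem GCC.le_mul_norm {T κ : ℝ} (h : GCC V σ T κ) (hne : V.Nonempty) : κ ≤ T * ‖σ‖ := by
  obtain ⟨v, hv⟩ := hne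
  have h1 := h.2.2 0 ⟨v, hv⟩
  have h2 := intervalIntegral.norm_integral_le_of_norm_le_const (a := 0) (b := T) (C := ‖σ‖)
    (f := fun t => σ (0 + toTorus (t • v))) fun t _ => σ.norm_coe_le_norm _
  rw [sub_zero, abs_of_pos h.1] at h2
  linarith [le_abs_self (∫ t in (0 : ℝ)..T, σ (0 + toTorus (t • v))),
    Real.norm_eq_abs (∫ t in (0 : ℝ)..T, σ (0 + toTorus (t • v)))]

/-- From κ ≤ T‖σ‖ ≤ e^{T‖σ‖}, both factors κ are absorbed by e^{-2T‖σ‖}; then γ ≤ 1 and β < 1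
finish, the latter giving strictness. -/
theorem IsScattering.minorant_lt_one (h : IsScattering V p γ) {Ts β T κ : ℝ}
    (hs : SpreadsMass V Ts β) (hc : GCC V σ T κ) :
    β * γ ^ 2 * κ ^ 2 * Real.exp (-(2 * T + Ts) * ‖σ‖) < 1 := by
  have hκ := hc.2.1
  have hβ := hs.2.1
  have hκM := hc.le_mul_norm h.nonempty
  have h1 : κ * Real.exp (-(T * ‖σ‖)) ≤ 1 := by
    rw [Real.exp_neg, ← div_eq_mul_inv, div_le_one (Real.exp_pos _)]
    linarith [Real.add_one_le_exp (T * ‖σ‖)]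
  have h2 : Real.exp (-(2 * T + Ts) * ‖σ‖)
      = Real.exp (-(T * ‖σ‖)) ^ 2 * Real.exp (-(Ts * ‖σ‖)) := by
    rw [← Real.exp_nat_mul, ← Real.exp_add]
    congr 1
    push_cast
    ring
  have h3 : Real.exp (-(Ts * ‖σ‖)) ≤ 1 :=
    Real.exp_le_one_iff.2 (neg_nonpos.2 (mul_nonneg hs.1 (norm_nonneg _)))
  have h4 : (κ * Real.exp (-(T * ‖σ‖))) ^ 2 ≤ 1 := pow_le_one₀ (by positivity) h1
  have h5 : γ ^ 2 ≤ 1 := pow_le_one₀ h.pos.le h.gamma_le_one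
  calc β * γ ^ 2 * κ ^ 2 * Real.exp (-(2 * T + Ts) * ‖σ‖)
      = β * (γ ^ 2 * ((κ * Real.exp (-(T * ‖σ‖))) ^ 2 * Real.exp (-(Ts * ‖σ‖)))) := by
        rw [h2]; ring
    _ ≤ β * 1 := by
        refine mul_le_mul_of_nonneg_left ?_ hβ.1.le
        exact mul_le_one₀ h5 (by positivity) (mul_le_one₀ h4 (Real.exp_pos _).le h3)
    _ < 1 := by rw [mul_one]; exact hβ.2

theorem IsScattering.minorant_pos (h : IsScattering V p γ) {Ts β T κ : ℝ}
    (hs : SpreadsMass V Ts β) (hc : GCC V σ T κ) :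
    0 < β * γ ^ 2 * κ ^ 2 * Real.exp (-(2 * T + Ts) * ‖σ‖) := by
  have hκ := hc.2.1
  have hβ := hs.2.1.1
  have hγ := h.pos
  positivity

theorem IsScattering.rate_pos (h : IsScattering V p γ) {Ts β T κ : ℝ}
    (hs : SpreadsMass V Ts β) (hc : GCC V σ T κ) : 0 < rate T Ts β γ κ ‖σ‖ := by
  have h1 := h.minorant_pos hs hc
  have h2 := h.minorant_lt_one hs hc
  have h3 : 0 < 2 * T + Ts := by linarith [hc.1, hs.1]
  have h4 := Real.log_neg (sub_pos.2 h2) (by linarith)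
  unfold rate
  rw [neg_mul, neg_pos]
  exact mul_neg_of_pos_of_neg (by positivity) h4

/-- Convergence to equilibrium for the solution with values in kernels. -/
theorem IsMild.tvDist_nu_le (h : IsScattering V p γ) (hσ : ∀ x, 0 ≤ σ x) {Ts β T κ : ℝ}
    (hs : SpreadsMass V Ts β) (hc : GCC V σ T κ) {μ : Kernel ℝ (Phase V)} [IsMarkovKernel μ]
    (hμ : IsMild σ p 0 μ) {t : ℝ} (ht : 0 ≤ t) :
    tvDist (μ t) (nu V) ≤ Real.exp (-rate T Ts β γ κ ‖σ‖ * (t - 2 * T - Ts))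
      * tvDist (μ 0) (nu V) := by
  have := h.isProbabilityMeasure_nu
  set α := β * γ ^ 2 * κ ^ 2 * Real.exp (-(2 * T + Ts) * ‖σ‖) with hα
  set τ := 2 * T + Ts with hτ
  have hτ0 : 0 < τ := by linarith [hc.1, hs.1]
  have hα0 := h.minorant_pos hs hc
  have hα1 := h.minorant_lt_one hs hc
  have hlow : ∀ g : Phase V → ℝ≥0∞, Measurable g → ∀ z,
      ENNReal.ofReal (α * Real.exp (‖σ‖ * τ)) * ∫⁻ y, g y ∂(nu V)
        ≤ dyson (jumpAlong V σ p) τ (fun y => g (flow V τ y)) z := by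
    intro g hg z
    have e : α * Real.exp (‖σ‖ * τ) = β * γ ^ 2 * κ ^ 2 := by
      rw [hα, mul_assoc, ← Real.exp_add]
      have : -τ * ‖σ‖ + ‖σ‖ * τ = 0 := by ring
      rw [this, Real.exp_zero, mul_one]
    rw [e]
    exact h.minorization hσ hs hc hg z
  have hcon : ∀ a, 0 ≤ a → tvDist (μ (a + τ)) (nu V) ≤ (1 - α) * tvDist (μ a) (nu V) := by
    intro a ha
    exact (hμ.shift ha).tvDist_le h hσ hτ0.le (h.isMild_nu hσ a) hα0.le hα1 hlow
  -- Contraction with α = 0, where the minorization is trivial: the evolution is non-expansive over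
  -- any time.
  have hnon : ∀ r, 0 ≤ r → tvDist (μ r) (nu V) ≤ tvDist (μ 0) (nu V) := by
    intro r hr
    have := hμ.tvDist_le h hσ hr (h.isMild_nu hσ 0) le_rfl one_pos (fun g _ z => by simp)
    simpa using this
  have hiter : ∀ (n : ℕ) (r : ℝ), 0 ≤ r →
      tvDist (μ (r + n * τ)) (nu V) ≤ (1 - α) ^ n * tvDist (μ 0) (nu V) := by
    intro n r hr
    induction n with
    | zero => simpa using hnon r hr
    | succ n ih =>
      have h1 := hcon (r + n * τ) (by positivity)
      have e : r + ((n + 1 : ℕ) : ℝ) * τ = r + n * τ + τ := by push_cast; ring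
      rw [e, pow_succ', mul_assoc]
      exact h1.trans (mul_le_mul_of_nonneg_left ih (sub_pos.2 hα1).le)
  -- The leftover time t - nτ, shorter than a period, is spent first without gain, followed by n
  -- contracting periods. As nτ > t - τ, at most one factor e^{λτ} is lost.
  set n := ⌊t / τ⌋₊ with hn
  have hn1 : (n : ℝ) * τ ≤ t := by
    have := Nat.floor_le (div_nonneg ht hτ0.le)
    rwa [le_div_iff₀ hτ0] at this
  have hn2 : t - τ < n * τ := by
    have := Nat.lt_floor_add_one (t / τ)
    rw [div_lt_iff₀ hτ0] at this
    linarith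
  have hmain := hiter n (t - n * τ) (sub_nonneg.2 hn1)
  rw [sub_add_cancel] at hmain
  refine hmain.trans (mul_le_mul_of_nonneg_right ?_ (tvDist_nonneg _ _))
  have hrate : (1 - α) ^ n = Real.exp (-rate T Ts β γ κ ‖σ‖ * (n * τ)) := by
    have e : -rate T Ts β γ κ ‖σ‖ * (n * τ) = n * Real.log (1 - α) := by
      unfold rate
      rw [← hτ, ← hα]
      field_simp
    rw [e, Real.exp_nat_mul, Real.exp_log (sub_pos.2 hα1)]
  rw [hrate, Real.exp_le_exp]
  have hr := h.rate_pos hs hc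
  have : t - 2 * T - Ts ≤ n * τ := by rw [hτ] at hn2 ⊢; linarith
  nlinarith [mul_le_mul_of_nonneg_left this hr.le]

end Rate

end Boltzmann

end

theorem theorem1 {d : ℕ} (V : Set (Boltzmann.Vel d)) (hV_open : IsOpen V)
    (hV_bdd : Bornology.IsBounded V) (hV_ne : V.Nonempty)
    (p : V → V → ℝ) (hp_meas : Measurable (Function.uncurry p))
    (γ : ℝ) (hγ : 0 < γ) (hp_lower : ∀ v v' : V, γ / volume.real V ≤ p v v')
    -- collisions conserve mass
    (hp_mass : ∀ v' : V, ∫ v, p v v' ∂(Boltzmann.leb V) = 1)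
    -- the uniform distribution of velocities is an equilibrium of the collisions
    (hp_equil : ∀ᵐ v ∂(Boltzmann.leb V), ∫ v', p v v' ∂(Boltzmann.leb V) = 1) :
    (∃ Tstar β : ℝ, Boltzmann.SpreadsMass V Tstar β) ∧
    ∀ Tstar β : ℝ, Boltzmann.SpreadsMass V Tstar β →
      ∀ σ : C(Boltzmann.Torus d, ℝ), (∀ x, 0 ≤ σ x) →
      ∀ T κ : ℝ, Boltzmann.GCC V σ T κ →
        0 < Boltzmann.rate T Tstar β γ κ ‖σ‖ ∧
        ∀ (μ₀ : ProbabilityMeasure (Boltzmann.Phase V))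
          (μ : ℝ → ProbabilityMeasure (Boltzmann.Phase V)),
          Boltzmann.IsMeasureSolution V σ p μ₀ μ →
          ∀ t : ℝ, Tstar ≤ t →
            Boltzmann.tvDist (μ t : Measure (Boltzmann.Phase V)) (Boltzmann.nu V)
              ≤ Real.exp (-Boltzmann.rate T Tstar β γ κ ‖σ‖ * (t - 2 * T - Tstar))
                * Boltzmann.tvDist (μ₀ : Measure (Boltzmann.Phase V)) (Boltzmann.nu V) := by
  have h : Boltzmann.IsScattering V p γ :=
    ⟨hV_open, hV_bdd, hV_ne, hp_meas, hγ, hp_lower, hp_mass, hp_equil⟩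
  refine ⟨Boltzmann.exists_spreadsMass hV_open hV_bdd hV_ne, ?_⟩
  intro Ts β hs σ hσ T κ hc
  refine ⟨h.rate_pos hs hc, fun μ₀ μ hμ t ht => ?_⟩
  have ht0 : 0 ≤ t := hs.1.trans ht
  have h1 := (hμ.isMild h hσ).tvDist_nu_le h hσ hs hc ht0
  rw [hμ.kernel_apply, hμ.kernel_apply, max_eq_left ht0, max_self, hμ.apply_zero h hσ] at h1
  exact h1
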